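/- **Setting.** Let $d\ge 1$ and $\Theta=\{\eta\in\mathbb R^d: |\eta|=1,\ \eta_1\ge 0\}$, where $|\cdot|$ is the Euclidean norm. Let $(x_i,y_i)_{i\ge1}$ be i.i.d. copies of $(X,Y)$ with $$Y=m_0(\theta_0^\top X)+\epsilon,\qquad \mathbb E(\epsilon\mid X)=0\ \text{a.e. } X,$$ where $X\in\mathbb R^d$, $\theta_0\in\Theta$, and $m_0$ is an unknown convex link function. Let $P_X$ be the law of $X$, $\chi$ its support, and $D=\{\theta^\top x: x\in\chi,\ \theta\in\Theta\}$ (an interval for $d\ge 2$; for $d=1$ it is understood to be one, so that convexity on $D$ makes sense). Let $\mathcal R$ be the class of convex functions on $D$ that have an absolutely continuous first derivative (one-sided at the end points of $D$), and put $J^2(m)=\int_D\{m''(t)\}^2\,dt\in[0,\infty]$, $\|m\|_\infty=\sup_{t\in D}|m(t)|$, $\|g\|^2=\int g^2\,dP_X$, and $(m\circ\theta)(x)=m(\theta^\top x)$. For each $n\ge1$ let $\hat\lambda_n$ be a real random variable with $\hat\lambda_n\ne0$ almost surely. A penalized least squares estimator (PLSE) $(\hat m,\hat\theta)=(\hat m_n,\hat\theta_n)$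 is any (possibly non-measurable) choice, almost surely, of a minimizer over $(m,\theta)\in\mathcal R\times\Theta$ of $$\frac1n\sum_{i=1}^n\{y_i-m(\theta^\top x_i)\}^2+\hat\lambda_n^2J^2(m).$$ **Assumptions.** - **(A0)** $\theta_{0,1}>0$, and for some $d_1\in\{1,\dots,d\}$ the variables $X_1,\dots,X_{d_1}$ have continuous (i.e. atomless) distributions and $X_{d_1+1},\dots,X_d$ are discrete. Moreover there are a nonempty open interval $\mathcal I$ and vectors $c_0,\dots,c_{d-d_1}\in\mathbb R^{d-d_1}$ such that $c_l-c_0$, $1\le l\le d-d_1$, are linearly independent and $\mathcal I\subset\bigcap_{l=0}^{d-d_1}\{\theta_0^\top x: x\in\chi,\ (x_{d_1+1},\dots,x_d)=c_l\}$. - **(A1)** $\chi$ is compact, with $\sup_{x\in\chi}|x|\le T$ for some $T$. - **(A2)** There is $K_1>0$ with $K_1\,\mathbb E[\exp(\epsilon^2/K_1)-1\mid X]\le1$ a.e. $X$. - **(A3)** The matrix $\mathbb E[XX^\top\{m_0'(\theta_0^\top X)\}^2]$ is nonsingular. - **(A4)** $\mathrm{Var}(X)$ is positive definite. - **(P1)**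 $m_0$ is convex and bounded on $D$, has an absolutely continuous first derivative there, and $J(m_0)<\infty$. - **(P2)** $\hat\lambda_n^{-1}=O_p(n^{2/5})$ and $\hat\lambda_n=o_p(n^{-1/4})$. **Theorem.** Under (A0)–(A4) and (P1)–(P2), as $n\to\infty$, $$J(\hat m)=O_p(1),\qquad \|\hat m\|_\infty=O_p(1),\qquad \|\hat m\circ\hat\theta-m_0\circ\theta_0\|=O_p(\hat\lambda_n).$$ Here $U_n=O_p(a_n)$, for possibly random $a_n$, means that for every $\varepsilon>0$ there is $M<\infty$ with $\mathbb P(|U_n|>M|a_n|)\le\varepsilon$ for all large $n$, and $U_n=o_p(a_n)$ means $\mathbb P(|U_n|>c|a_n|)\to0$ for every $c>0$; outer probability is used for events that need not be measurable. -/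

import Mathlib

open MeasureTheory ProbabilityTheory Filter Set
open scoped ENNReal NNReal Topology

namespace ConvexSIM

noncomputable section

/-- The parameter space `Θ = {η ∈ ℝᵈ : |η| = 1, η₁ ≥ 0}`. -/
def Theta (d : ℕ) [NeZero d] : Set (EuclideanSpace ℝ (Fin d)) :=
  {η | ‖η‖ = 1 ∧ 0 ≤ η 0}

/-- The index set `D = {θᵀx : x ∈ χ, θ ∈ Θ}`, where `χ` is the support of the law `P` of `X`. -/
def indexSet {d : ℕ} [NeZero d] (P : Measure (EuclideanSpace ℝ (Fin d))) : Set ℝ :=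
  {t | ∃ θ ∈ Theta d, ∃ x ∈ P.support, t = inner ℝ θ x}

/-- `m` has an absolutely continuous first derivative on `D` (one-sided at the end points). Only
the values of `m` on `D` matter. For compact `D` the condition on all `a, b ∈ D` is absolute
continuity on `D`. -/
def HasACDerivOn (D : Set ℝ) (m : ℝ → ℝ) : Prop :=
  DifferentiableOn ℝ m D ∧
    ∀ a ∈ D, ∀ b ∈ D, AbsolutelyContinuousOnInterval (derivWithin m D) a b

/-- The class `𝓡` of convex functions on `D` with an absolutely continuous first derivative. -/
def classR (D : Set ℝ) : Set (ℝ → ℝ) :=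
  {m | ConvexOn ℝ D m ∧ HasACDerivOn D m}

/-- `J²(m) = ∫_D (m'')²`, with value `∞` if the second derivative is not square integrable. -/
def roughnessSq (D : Set ℝ) (m : ℝ → ℝ) : ℝ≥0∞ :=
  ∫⁻ t in D, ‖derivWithin (derivWithin m D) D t‖ₑ ^ 2

/-- `J(m)`. -/
def roughness (D : Set ℝ) (m : ℝ → ℝ) : ℝ≥0∞ :=
  roughnessSq D m ^ (1 / 2 : ℝ)

/-- The supremum norm `sup_{t ∈ D} |m t|`, possibly `∞`. -/
def supNormOn (D : Set ℝ) (m : ℝ → ℝ) : ℝ≥0∞ :=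
  ⨆ t ∈ D, ‖m t‖ₑ

/-- The least squares loss `Qₙ(m, θ) = n⁻¹ ∑ (yᵢ - m(θᵀxᵢ))²` of the data `x₀, …, xₙ₋₁` and
`y₀, …, yₙ₋₁`. -/
def lossQ {d : ℕ} (n : ℕ) (x : ℕ → EuclideanSpace ℝ (Fin d)) (y : ℕ → ℝ)
    (m : ℝ → ℝ) (θ : EuclideanSpace ℝ (Fin d)) : ℝ :=
  (∑ i ∈ Finset.range n, (y i - m (inner ℝ θ (x i))) ^ 2) / n

/-- The penalized loss `𝓛ₙ(m, θ; lam) = Qₙ(m, θ) + lam² J²(m)`. -/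
def penalizedLoss {d : ℕ} (D : Set ℝ) (n : ℕ) (x : ℕ → EuclideanSpace ℝ (Fin d)) (y : ℕ → ℝ)
    (lam : ℝ) (m : ℝ → ℝ) (θ : EuclideanSpace ℝ (Fin d)) : ℝ≥0∞ :=
  ENNReal.ofReal (lossQ n x y m θ) + ENNReal.ofReal (lam ^ 2) * roughnessSq D m

/-- `(m, θ)` is a penalized least squares estimate for the given data: a minimizer of `𝓛ₙ` over
`𝓡 × Θ`. -/
def IsPLSE {d : ℕ} [NeZero d] (D : Set ℝ) (n : ℕ) (x : ℕ → EuclideanSpace ℝ (Fin d))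
    (y : ℕ → ℝ) (lam : ℝ) (m : ℝ → ℝ) (θ : EuclideanSpace ℝ (Fin d)) : Prop :=
  m ∈ classR D ∧ θ ∈ Theta d ∧
    ∀ m₁ ∈ classR D, ∀ θ₁ ∈ Theta d,
      penalizedLoss D n x y lam m θ ≤ penalizedLoss D n x y lam m₁ θ₁

/-- `U n = O_p(a n)` for nonnegative (extended real) `U n` and (possibly random) rates `a n`. On
sets that are not measurable, `μ` is the outer probability. -/
def IsBigOp {Ω : Type*} [MeasurableSpace Ω] (μ : Measure Ω) (U a : ℕ → Ω → ℝ≥0∞) : Prop :=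
  ∀ ε : ℝ≥0∞, 0 < ε → ∃ M : ℝ≥0, ∀ᶠ n in atTop, μ {ω | (M : ℝ≥0∞) * a n ω < U n ω} ≤ ε

/-- `U n = o_p(a n)`. -/
def IsLittleOp {Ω : Type*} [MeasurableSpace Ω] (μ : Measure Ω) (U a : ℕ → Ω → ℝ≥0∞) : Prop :=
  ∀ c : ℝ≥0, 0 < c → Tendsto (fun n => μ {ω | (c : ℝ≥0∞) * a n ω < U n ω}) atTop (𝓝 0)

/-- (A0). The first `d₁` covariates have continuous (atomless) distributions, the others are
discrete, `θ₀` has a positive first coordinate, and some nonempty open interval is covered by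
the index `θ₀ᵀx` on each of `d - d₁ + 1` affinely independent slices of the support on which the
discrete covariates are fixed. -/
def AssumptionA0 {d : ℕ} [NeZero d] (P : Measure (EuclideanSpace ℝ (Fin d)))
    (θ₀ : EuclideanSpace ℝ (Fin d)) : Prop :=
  0 < θ₀ 0 ∧
  ∃ d₁ : ℕ, 1 ≤ d₁ ∧ d₁ ≤ d ∧
    (∀ j : Fin d, (j : ℕ) < d₁ → ∀ t : ℝ, P {x | x j = t} = 0) ∧
    (∀ j : Fin d, d₁ ≤ (j : ℕ) → ∃ S : Set ℝ, S.Countable ∧ ∀ᵐ x ∂P, x j ∈ S) ∧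
    ∃ a b : ℝ, a < b ∧ ∃ c : Fin (d - d₁ + 1) → {j : Fin d // d₁ ≤ (j : ℕ)} → ℝ,
      LinearIndependent ℝ (fun l : Fin (d - d₁) => c l.succ - c 0) ∧
      ∀ l, Ioo a b ⊆ {t | ∃ x ∈ P.support,
        (∀ j : {j : Fin d // d₁ ≤ (j : ℕ)}, x j = c l j) ∧ t = inner ℝ θ₀ x}

/-- (A1). The support of `X` is compact, and contained in the ball of some radius `T`. -/
def AssumptionA1 {d : ℕ} (P : Measure (EuclideanSpace ℝ (Fin d))) : Prop :=
  IsCompact P.support ∧ ∃ T : ℝ, ∀ x ∈ P.support, ‖x‖ ≤ T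

/-- (A2). `E(e | X) = 0` and `K₁ E(exp(e² / K₁) - 1 | X) ≤ 1` almost everywhere, for some
`K₁ > 0`. -/
def AssumptionA2 {d : ℕ} {Ω : Type*} [MeasurableSpace Ω] (μ : Measure Ω)
    (X : Ω → EuclideanSpace ℝ (Fin d)) (e : Ω → ℝ) : Prop :=
  Integrable e μ ∧ μ[e | MeasurableSpace.comap X inferInstance] =ᵐ[μ] 0 ∧
  ∃ K₁ : ℝ, 0 < K₁ ∧ Integrable (fun ω => Real.exp (e ω ^ 2 / K₁) - 1) μ ∧
    ∀ᵐ ω ∂μ,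
      K₁ * (μ[fun ω' => Real.exp (e ω' ^ 2 / K₁) - 1 | MeasurableSpace.comap X inferInstance]) ω
        ≤ 1

/-- (A3). The matrix `E[X Xᵀ {m₀'(θ₀ᵀX)}²]` is nonsingular. -/
def AssumptionA3 {d : ℕ} [NeZero d] (P : Measure (EuclideanSpace ℝ (Fin d))) (m₀ : ℝ → ℝ)
    (θ₀ : EuclideanSpace ℝ (Fin d)) : Prop :=
  IsUnit (Matrix.of fun i j : Fin d =>
    ∫ x, x i * x j * (derivWithin m₀ (indexSet P) (inner ℝ θ₀ x)) ^ 2 ∂P)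

/-- (A4). The covariance matrix of `X` is positive definite. -/
def AssumptionA4 {d : ℕ} (P : Measure (EuclideanSpace ℝ (Fin d))) : Prop :=
  (Matrix.of fun i j : Fin d =>
    cov[fun x : EuclideanSpace ℝ (Fin d) => x i, fun x => x j; P]).PosDef

/-- (P1). `m₀` is convex and bounded on `D`, has an absolutely continuous first derivative, and
`J(m₀) < ∞`. -/
def AssumptionP1 (D : Set ℝ) (m₀ : ℝ → ℝ) : Prop :=
  m₀ ∈ classR D ∧ (∃ M₀ : ℝ, ∀ t ∈ D, |m₀ t| ≤ M₀) ∧ roughness D m₀ < ∞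

/-- (P2). `lam n ^ (-1) = O_p(n ^ (2/5))` and `lam n = o_p(n ^ (-1/4))`. -/
def AssumptionP2 {Ω : Type*} [MeasurableSpace Ω] (μ : Measure Ω) (lam : ℕ → Ω → ℝ) : Prop :=
  IsBigOp μ (fun n ω => ‖lam n ω‖ₑ⁻¹) (fun n _ => (n : ℝ≥0∞) ^ (2 / 5 : ℝ)) ∧
  IsLittleOp μ (fun n ω => ‖lam n ω‖ₑ) (fun n _ => (n : ℝ≥0∞) ^ (-(1 / 4) : ℝ))

end

end ConvexSIM

/-!
The estimator is compared with the truth through the penalized loss, and the resulting empirical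
process is controlled by the metric entropy of convex functions.

*Basic inequality.* Comparing the penalized loss at `(m̂, θ̂)` with its value at `(m₀, θ₀)` bounds
`‖g‖ₙ² + λ² J²(m̂)` by `2 ⟨e, g⟩ₙ + λ² J²(m₀)`, where `g = m̂ ∘ θ̂ - m₀ ∘ θ₀`, `e` is the error, and
`‖·‖ₙ`, `⟨·, ·⟩ₙ` are the empirical norm and inner product (`IsPLSE.basic_inequality`).

*Entropy.* Convex functions on `[a, b]` with values and slopes bounded by one are determined, up to
a uniform error of order `N⁻²`, by their values on a mesh of `N` cells and the values of their
convex conjugates on a mesh of `N` slopes, both up to an error `N⁻²`; the conjugates provide supporting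
lines (`unitClass.le_add_of_mesh`). On either mesh the values, multiplied by `N²`, form a convex
sequence. The integer parts of its increments are monotone, so `2 ^ (C N)` labels suffice to code it
up to a unit error (`codable_convexSeq`, `codable_unitClass`). The directions `θ` add only
polynomially many labels (`exists_hasConvexEntropy`).

*Empirical processes.* The assumption on the errors yields `E exp (e h(X) - c h(X)²) ≤ 1` for every
bounded `h` (`AssumptionA2.exists_lintegral_exp_le_one`). Hence `∑ (eᵢ h(xᵢ) - c h(xᵢ)²)` has an
exponential tail that does not depend on `h`. The quadratic term takes the place of a localization:
it is eventually absorbed by `‖g‖ₙ²`. Let `k = ⌊log₃₂ n⌋`, so that `2 ^ k` is of order `n ^ (1/5)`.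
Chaining along the nets for `N = 2 ^ k, …, 2 ^ (2 k)` gives, with high probability and uniformly
over differences `h` of two single index functions with links in the unit class,
`∑ eᵢ h(xᵢ) ≤ (1 / 8) ∑ h(xᵢ)² + D 2 ^ k` (`exists_measure_multiplier_le`). An exponential
inequality for `n E h(X)² - 2 ∑ h(xᵢ)²` on the first of these nets similarly bounds `n E h(X)²` by
`8 ∑ h(xᵢ)² + D 2 ^ k` (`exists_measure_norm_le`). The error terms, divided by `n`, are of order
`n ^ (-4/5)`, which by the lower bound on `λ` is at most of order `λ²`.

*Size.* A function `m` in the class differs from an affine function of the index by at most a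
multiple of `J(m)`. Since the covariance matrix of `X` is positive definite, the variance of `θᵀX`
is bounded below uniformly over unit vectors `θ`, so the affine part is controlled by
`‖m ∘ θ‖ + J(m)`. This bounds `‖m‖_∞` and the slopes of `m` (`exists_abs_le_roughness_add_norm`).

*Conclusion.* Dividing `m̂` and `m₀` by a common scale `S` of order `1 + J(m̂) + ‖m̂ ∘ θ̂‖` puts
them into the unit class, and scaling back gives the two empirical bounds with error terms of order
`S 2 ^ k / n` and `S² 2 ^ k / n` (`error_bounds_of_scale`). Together with the basic inequality they
form a system of quadratic inequalities for `J(m̂)`, `‖m̂ ∘ θ̂‖` and `‖g‖`, in which the error terms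
can be absorbed because `2 ^ k / n` tends to zero and is at most of order `λ²`
(`exists_bound_of_basic_inequality`). The resulting statement
`exists_bound_of_empirical_bounds` is deterministic: it holds at every sample point at which the
empirical bounds hold and `λ` has the required order.
-/

/-! ### Finite codes -/

namespace ConvexSIM

/-- `Codable S R M`: the elements of `S` can be given one of `M` labels in such a way that two
elements with the same label are related by `R`. With `R` the relation of being `δ`-close this
bounds a covering number of `S`, with centres in `S`, by `M`. -/
def Codable {α : Type*} (S : Set α) (R : α → α → Prop) (M : ℕ) : Prop :=
  ∃ c : S → Fin M, ∀ x y : S, c x = c y → R x y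

namespace Codable

variable {α β κ : Type*} {S : Set α} {R R' : α → α → Prop} {M M' : ℕ}

lemma of_finset (T : Finset κ) (c : α → κ) (hc : ∀ x ∈ S, c x ∈ T)
    (h : ∀ x ∈ S, ∀ y ∈ S, c x = c y → R x y) : Codable S R T.card := by
  refine ⟨fun x => T.equivFin ⟨c x, hc x x.2⟩, fun x y hxy => h x x.2 y y.2 ?_⟩
  simpa using hxy

lemma mono (h : Codable S R M) (hM : M ≤ M') (hR : ∀ x ∈ S, ∀ y ∈ S, R x y → R' x y) :
    Codable S R' M' := by
  obtain ⟨c, hc⟩ := h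
  refine ⟨fun x => Fin.castLE hM (c x), fun x y hxy => hR x x.2 y y.2 (hc x y ?_)⟩
  simpa using hxy

lemma comap {S' : Set β} {Q : β → β → Prop} (h : Codable S' Q M) (f : α → β)
    (hf : MapsTo f S S') : Codable S (fun x y => Q (f x) (f y)) M := by
  obtain ⟨c, hc⟩ := h
  exact ⟨fun x => c ⟨f x, hf x.2⟩, fun x y hxy => hc _ _ hxy⟩

lemma inf (h : Codable S R M) (h' : Codable S R' M') :
    Codable S (fun x y => R x y ∧ R' x y) (M * M') := by
  obtain ⟨c, hc⟩ := h
  obtain ⟨c', hc'⟩ := h'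
  refine ⟨fun x => finProdFinEquiv (c x, c' x), fun x y hxy => ?_⟩
  have := finProdFinEquiv.injective hxy
  simp only [Prod.mk.injEq] at this
  exact ⟨hc x y this.1, hc' x y this.2⟩

/-- A code yields a finite net inside the set. -/
lemma exists_net (h : Codable S R M) :
    ∃ (T : Finset α) (π : α → α), T.card ≤ M ∧
      (∀ x ∈ S, π x ∈ T) ∧ (∀ x ∈ T, x ∈ S) ∧ ∀ x ∈ S, R x (π x) := by
  classical
  obtain ⟨c, hc⟩ := h
  let r : Fin M → Option S := fun i => if h : ∃ x, c x = i then some h.choose else none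
  have hr : ∀ x : S, ∃ y : S, r (c x) = some y ∧ c y = c x := fun x => by
    have hx : ∃ y, c y = c x := ⟨x, rfl⟩
    exact ⟨hx.choose, dif_pos hx, hx.choose_spec⟩
  choose f hf1 hf2 using hr
  refine ⟨(Finset.univ.image r).eraseNone.map (Function.Embedding.subtype _),
    fun x => if h : x ∈ S then f ⟨x, h⟩ else x, ?_, ?_, ?_, ?_⟩
  · rw [Finset.card_map]
    refine (Finset.card_eraseNone_le _).trans (Finset.card_image_le.trans (by simp))
  · intro x hx
    simp only [hx, dif_pos, Finset.mem_map, Finset.mem_eraseNone]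
    exact ⟨_, Finset.mem_image.2 ⟨_, Finset.mem_univ _, hf1 ⟨x, hx⟩⟩, rfl⟩
  · intro x hx
    simp only [Finset.mem_map] at hx
    obtain ⟨y, -, rfl⟩ := hx
    exact y.2
  · intro x hx
    simp only [hx, dif_pos]
    exact hc ⟨x, hx⟩ _ (hf2 ⟨x, hx⟩).symm

end Codable

/-! ### Metric entropy of bounded convex functions -/

/-- Real sequences that are convex up to the index `N`, with first term and increments bounded by
multiples of `N ^ 2` and `N`. -/
def convexSeq (B N : ℕ) : Set (ℕ → ℝ) :=
  {z | |z 0| ≤ B * N ^ 2 ∧ (∀ i < N, |z (i + 1) - z i| ≤ B * N) ∧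
    ∀ i, i + 1 < N → z (i + 1) - z i ≤ z (i + 2) - z (i + 1)}

lemma sq_le_two_pow (N : ℕ) : N ^ 2 ≤ 2 ^ (2 * N) := by
  have : N ≤ 2 ^ N := Nat.lt_two_pow_self.le
  calc N ^ 2 ≤ (2 ^ N) ^ 2 := Nat.pow_le_pow_left this 2
    _ = _ := by rw [← pow_mul, mul_comm]

/-- Convex sequences can be coded up to a unit error with a number of labels exponential in the
length: the integer parts of the increments form a monotone sequence, which after adding the
index is determined by its range, and the integer part of each term is recovered from the
preceding one, the integer part of the increment and a carry. -/
lemma codable_convexSeq (B N : ℕ) (hN : 1 ≤ N) :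
    Codable (convexSeq B N) (fun z w => ∀ i ≤ N, |z i - w i| ≤ 1) (2 ^ ((4 * B + 10) * N)) := by
  classical
  let u : (ℕ → ℝ) → Fin N → ℤ := fun z i => ⌊z (i + 1) - z i⌋ + (i : ℕ)
  let T : Finset (ℤ × Finset ℤ × Finset (Fin N)) :=
    Finset.Icc (-(B * N ^ 2 : ℤ)) (B * N ^ 2) ×ˢ
      ((Finset.Icc (-(B * N : ℤ)) (B * N + N)).powerset ×ˢ Finset.univ)
  let c : (ℕ → ℝ) → ℤ × Finset ℤ × Finset (Fin N) := fun z =>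
    (⌊z 0⌋, Finset.univ.image (u z),
      Finset.univ.filter fun i : Fin N => ⌊z (i + 1)⌋ = ⌊z i⌋ + ⌊z (i + 1) - z i⌋)
  have floor_mem : ∀ (x : ℝ) (k : ℕ), |x| ≤ k → -(k : ℤ) ≤ ⌊x⌋ ∧ ⌊x⌋ ≤ k := by
    intro x k h
    rw [abs_le] at h
    constructor
    · rw [Int.le_floor]; push_cast; exact h.1
    · have : (⌊x⌋ : ℝ) ≤ (k : ℤ) := (Int.floor_le x).trans (by push_cast; exact h.2)
      exact_mod_cast this
  have hmono : ∀ z ∈ convexSeq B N, StrictMono (u z) := by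
    intro z hz
    have h1 : ∀ j : ℕ, ∀ i, i + j < N → ⌊z (i + 1) - z i⌋ ≤ ⌊z (i + j + 1) - z (i + j)⌋ := by
      intro j
      induction j with
      | zero => intro i _; simp
      | succ j ih =>
        intro i hi
        refine (ih i (by omega)).trans (Int.floor_le_floor ?_)
        exact hz.2.2 (i + j) (by omega)
    intro i j hij
    obtain ⟨k, hk⟩ := Nat.exists_eq_add_of_lt (Fin.lt_def.1 hij)
    have := h1 (k + 1) i (by have := j.2; omega)
    have e : (j : ℕ) = i + (k + 1) := by omega
    simp only [u, e]
    push_cast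
    linarith
  have main : Codable (convexSeq B N) (fun z w => ∀ i ≤ N, |z i - w i| ≤ 1) T.card := by
    refine Codable.of_finset T c ?_ ?_
    · intro z hz
      have h0 := floor_mem (z 0) (B * N ^ 2) (by push_cast; exact hz.1)
      simp only [T, c, Finset.mem_product, Finset.mem_Icc, Finset.mem_powerset, Finset.mem_univ,
        and_true]
      refine ⟨by push_cast at h0; exact ⟨h0.1, h0.2⟩, fun k hk => ?_⟩
      obtain ⟨i, -, rfl⟩ := Finset.mem_image.1 hk
      have := floor_mem _ (B * N) (by push_cast; exact hz.2.1 i i.2)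
      push_cast at this
      have hi : ((i : ℕ) : ℤ) < N := by exact_mod_cast i.2
      have hi0 : (0 : ℤ) ≤ (i : ℕ) := by positivity
      simp only [u, Finset.mem_Icc]
      constructor <;> linarith
    · intro z hz w hw hzw
      simp only [c, Prod.mk.injEq] at hzw
      obtain ⟨h0, hu, hb⟩ := hzw
      have huw : u z = u w := by
        refine ((hmono z hz).range_inj (hmono w hw)).1 ?_
        have := congrArg (fun s : Finset ℤ => (s : Set ℤ)) hu
        simpa using this
      have hfl : ∀ i ≤ N, ⌊z i⌋ = ⌊w i⌋ := by
        intro i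
        induction i with
        | zero => intro _; exact h0
        | succ i ih =>
          intro hi
          have e1 := ih (by omega)
          have e2 := congrFun huw ⟨i, hi⟩
          have e3 := Finset.ext_iff.1 hb ⟨i, hi⟩
          simp only [Finset.mem_filter, Finset.mem_univ, true_and] at e3
          simp only [u, add_left_inj] at e2
          have a1 := Int.le_floor_add (z i) (z (i + 1) - z i)
          have a2 := Int.le_floor_add_floor (z i) (z (i + 1) - z i)
          have b1 := Int.le_floor_add (w i) (w (i + 1) - w i)
          have b2 := Int.le_floor_add_floor (w i) (w (i + 1) - w i)
          rw [add_sub_cancel] at a1 a2 b1 b2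
          omega
      intro i hi
      have h1 := hfl i hi
      exact (Int.abs_sub_lt_one_of_floor_eq_floor h1).le
  refine main.mono ?_ (fun _ _ _ _ h => h)
  have hT : T.card = (2 * (B * N ^ 2) + 1) * (2 ^ (2 * (B * N) + N + 1) * 2 ^ N) := by
    simp only [T, Finset.card_product, Finset.card_powerset, Int.card_Icc, Finset.card_univ,
      Fintype.card_finset, Fintype.card_fin]
    have e : ((B : ℤ) * (N : ℤ) ^ 2) = ((B * N ^ 2 : ℕ) : ℤ) := by push_cast; rfl
    rw [e]
    congr 3
    · omega
    · omega
  rw [hT]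
  have h1 : 2 * (B * N ^ 2) + 1 ≤ 2 ^ (2 * B + 1 + 2 * N) := by
    have hB : 2 * B + 1 ≤ 2 ^ (2 * B + 1) := Nat.lt_two_pow_self.le
    calc 2 * (B * N ^ 2) + 1 ≤ (2 * B + 1) * N ^ 2 := by nlinarith [Nat.one_le_pow 2 N hN]
      _ ≤ 2 ^ (2 * B + 1) * 2 ^ (2 * N) := Nat.mul_le_mul hB (sq_le_two_pow N)
      _ = _ := by rw [pow_add _ (2 * B + 1)]
  calc _ ≤ 2 ^ (2 * B + 1 + 2 * N) * (2 ^ (2 * (B * N) + N + 1) * 2 ^ N) :=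
        Nat.mul_le_mul_right _ h1
    _ = 2 ^ (2 * B + 1 + 2 * N + (2 * (B * N) + N + 1 + N)) := by rw [← pow_add, ← pow_add]
    _ ≤ _ := Nat.pow_le_pow_right (by norm_num) (by nlinarith)

/-- The functions which on `[a, b]` are bounded by one and have at every point a supporting line
of slope at most one in absolute value; in particular they are convex and `1`-Lipschitz there. -/
def unitClass (a b : ℝ) : Set (ℝ → ℝ) :=
  {φ | ∀ t ∈ Icc a b, |φ t| ≤ 1 ∧ ∃ p, |p| ≤ 1 ∧ ∀ u ∈ Icc a b, φ t + p * (u - t) ≤ φ u}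

variable {a b : ℝ} {φ ψ : ℝ → ℝ}

lemma unitClass.abs_sub_le (hφ : φ ∈ unitClass a b) {s t : ℝ} (hs : s ∈ Icc a b)
    (ht : t ∈ Icc a b) : |φ s - φ t| ≤ |s - t| := by
  have key : ∀ s ∈ Icc a b, ∀ t ∈ Icc a b, φ t - φ s ≤ |s - t| := by
    intro s hs t ht
    obtain ⟨p, hp, h⟩ := (hφ t ht).2
    have h1 := h s hs
    have h2 : |p * (s - t)| ≤ |s - t| := by
      rw [abs_mul]; exact mul_le_of_le_one_left (abs_nonneg _) hp
    have := neg_abs_le (p * (s - t))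
    linarith
  rw [abs_le]
  have h1 := key s hs t ht
  have h2 := key t ht s hs
  rw [abs_sub_comm] at h2
  constructor <;> linarith

lemma unitClass.continuousOn (hφ : φ ∈ unitClass a b) : ContinuousOn φ (Icc a b) := by
  have : LipschitzOnWith 1 φ (Icc a b) :=
    LipschitzOnWith.of_dist_le_mul fun s hs t ht => by
      simpa [Real.dist_eq] using unitClass.abs_sub_le hφ hs ht
  exact this.continuousOn

/-- The convex conjugate of the restriction of `φ` to `[a, b]`. -/
noncomputable def conj (a b : ℝ) (φ : ℝ → ℝ) (s : ℝ) : ℝ := sSup ((fun u => s * u - φ u) '' Icc a b)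

lemma unitClass.exists_conj_eq (hab : a ≤ b) (hφ : φ ∈ unitClass a b) (s : ℝ) :
    ∃ u ∈ Icc a b, conj a b φ s = s * u - φ u ∧ ∀ t ∈ Icc a b, s * t - φ t ≤ conj a b φ s := by
  have hc : ContinuousOn (fun u => s * u - φ u) (Icc a b) :=
    (continuousOn_const.mul continuousOn_id).sub (unitClass.continuousOn hφ)
  obtain ⟨u, hu, hmax⟩ := isCompact_Icc.exists_isMaxOn (nonempty_Icc.2 hab) hc
  have hg : IsGreatest ((fun u => s * u - φ u) '' Icc a b) (s * u - φ u) :=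
    ⟨⟨u, hu, rfl⟩, by rintro _ ⟨t, ht, rfl⟩; exact hmax ht⟩
  refine ⟨u, hu, hg.csSup_eq, fun t ht => ?_⟩
  rw [conj, hg.csSup_eq]
  exact hmax ht

set_option maxHeartbeats 400000 in
/-- A convex function is determined up to an error `O(N⁻²)` by its values on a mesh of `N` points
and the values of its conjugate on a mesh of `N` slopes, both up to an error `N⁻²`. Near a point
where the supporting line of the nearest smaller mesh slope touches the graph within two mesh
cells, this line is a good minorant; otherwise the chord over the preceding mesh cell is. -/
lemma unitClass.le_add_of_mesh (hab : a < b) (hφ : φ ∈ unitClass a b) (hψ : ψ ∈ unitClass a b)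
    {N : ℕ} (hN : 1 ≤ N)
    (h1 : ∀ i ≤ N, |φ (a + i * ((b - a) / N)) - ψ (a + i * ((b - a) / N))| ≤ 1 / (N : ℝ) ^ 2)
    (h2 : ∀ i ≤ N, |conj a b φ (-1 + i * (2 / N)) - conj a b ψ (-1 + i * (2 / N))|
      ≤ 1 / (N : ℝ) ^ 2)
    {t : ℝ} (ht : t ∈ Icc a b) : φ t ≤ ψ t + (4 * (b - a) + 3) / (N : ℝ) ^ 2 := by
  have hN0 : (0 : ℝ) < N := by exact_mod_cast hN
  set h : ℝ := (b - a) / N with hh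
  have hba : 0 < b - a := sub_pos.2 hab
  have hpos : 0 < h := div_pos hba hN0
  have hNh : N * h = b - a := by rw [hh]; field_simp
  obtain ⟨p, hp, hsub⟩ := (hφ t ht).2
  rw [abs_le] at hp
  -- the mesh slope just below the slope of `φ` at `t`
  set i : ℕ := ⌊(p + 1) * N / 2⌋₊ with hi
  have hi1 : (i : ℝ) ≤ (p + 1) * N / 2 :=
    Nat.floor_le (by have := hp.1; have : 0 ≤ p + 1 := by linarith
                     positivity)
  have hi2 : (p + 1) * N / 2 < i + 1 := Nat.lt_floor_add_one _
  have hiN : i ≤ N := by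
    have : (i : ℝ) ≤ N := hi1.trans (by nlinarith [hp.2])
    exact_mod_cast this
  set s : ℝ := -1 + i * (2 / N) with hs
  have hs1 : s ≤ p := by
    have : i * (2 / (N : ℝ)) ≤ (p + 1) * N / 2 * (2 / N) := by gcongr
    have e : (p + 1) * N / 2 * (2 / (N : ℝ)) = p + 1 := by field_simp
    rw [hs]; linarith
  have hs2 : p - s ≤ 2 / N := by
    have : (p + 1) * N / 2 * (2 / N) ≤ (i + 1) * (2 / (N : ℝ)) := by gcongr
    have e : (p + 1) * N / 2 * (2 / (N : ℝ)) = p + 1 := by field_simp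
    rw [hs]; linarith
  obtain ⟨τ, hτ, hτ1, hτ2⟩ := unitClass.exists_conj_eq hab.le hφ s
  obtain ⟨-, -, -, hψ2⟩ := unitClass.exists_conj_eq hab.le hψ s
  have hc := abs_le.1 (h2 i hiN)
  have hN2 : (1 : ℝ) / N ^ 2 = 1 / N * (1 / N) := by field_simp
  have hbN : (4 * (b - a) + 3) / (N : ℝ) ^ 2 = 2 / N * (2 * h) + 3 * (1 / N ^ 2) := by
    rw [hh]; field_simp; ring
  have hδ : 0 < 1 / (N : ℝ) ^ 2 := by positivity
  rcases le_or_gt (t - 2 * h) τ with hcase | hcase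
  · have e1 := hψ2 t ht
    have e2 := hsub τ hτ
    have e3 : (p - s) * (t - τ) ≤ 2 / N * (2 * h) := by
      rcases le_or_gt t τ with h0 | h0
      · have : (p - s) * (t - τ) ≤ 0 :=
          mul_nonpos_of_nonneg_of_nonpos (by linarith) (by linarith)
        have : 0 ≤ 2 / N * (2 * h) := by positivity
        linarith
      · exact mul_le_mul hs2 (by linarith) (by linarith) (by positivity)
    have e4 : (p - s) * (t - τ) = s * τ - s * t - p * (τ - t) := by ring
    rw [hbN]
    linarith
  · -- the two mesh points preceding `t` lie to the right of `τ`
    set j : ℕ := ⌊(t - a) / h⌋₊ with hj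
    have hta : 0 ≤ (t - a) / h := div_nonneg (by linarith [ht.1]) hpos.le
    have hj1 : j * h ≤ t - a := by
      have := Nat.floor_le hta; rw [← hj] at this; rwa [le_div_iff₀ hpos] at this
    have hj2 : t - a < (j + 1) * h := by
      have := Nat.lt_floor_add_one ((t - a) / h); rw [← hj] at this
      rwa [div_lt_iff₀ hpos] at this
    have hj0 : j ≠ 0 := by
      intro h0; rw [h0] at hj2; push_cast at hj2; linarith [hτ.1]
    obtain ⟨k, hk⟩ := Nat.exists_eq_succ_of_ne_zero hj0
    have hjN : j ≤ N := by
      have : (j : ℝ) * h ≤ N * h := by rw [hNh]; linarith [ht.2]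
      exact_mod_cast le_of_mul_le_mul_right this hpos
    have hkj : (j : ℝ) = k + 1 := by rw [hk]; push_cast; ring
    set q : ℝ := a + j * h with hq
    set r : ℝ := a + k * h with hr
    have hqr : q - r = h := by rw [hq, hr, hkj]; ring
    have hqt : q ≤ t := by linarith
    have htq : t - q ≤ h := by rw [hq]; linarith
    have hτr : τ < r := by linarith
    have hrm : r ∈ Icc a b := ⟨by linarith [hτ.1], by linarith [ht.2]⟩
    have hqm : q ∈ Icc a b := ⟨by linarith [hrm.1], by linarith [ht.2]⟩
    -- the chord of `φ` has slope at least `s`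
    have hch : s * h ≤ φ q - φ r := by
      obtain ⟨p', -, hp'⟩ := (hφ r hrm).2
      have e1 := hp' τ hτ
      have e2 := hτ2 r hrm
      have e3 : s ≤ p' := by
        refine le_of_mul_le_mul_right (a := r - τ) ?_ (by linarith)
        have h3 : p' * (τ - r) = -(p' * (r - τ)) := by ring
        rw [mul_sub s]
        linarith
      have e4 := hp' q hqm
      rw [hqr] at e4
      have e5 := mul_le_mul_of_nonneg_right e3 hpos.le
      linarith
    have hψq : φ q + (t - q) * s - 3 * (1 / N ^ 2) ≤ ψ t := by
      obtain ⟨p', -, hp'⟩ := (hψ q hqm).2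
      have e1 := hp' r hrm
      have e2 := hp' t ht
      have e3 : -(1 / (N : ℝ) ^ 2) ≤ φ q - ψ q ∧ φ q - ψ q ≤ 1 / (N : ℝ) ^ 2 :=
        abs_le.1 (h1 j hjN)
      have e4 : -(1 / (N : ℝ) ^ 2) ≤ φ r - ψ r ∧ φ r - ψ r ≤ 1 / (N : ℝ) ^ 2 :=
        abs_le.1 (h1 k (by omega))
      have e5 : h * (s - p') ≤ 2 * (1 / (N : ℝ) ^ 2) := by
        have h3 : p' * (r - q) = -(h * p') := by rw [← hqr]; ring
        rw [mul_sub, mul_comm h s]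
        linarith [e3.1, e3.2, e4.1, e4.2]
      have e6 : (t - q) * (s - p') ≤ 2 * (1 / (N : ℝ) ^ 2) := by
        rcases le_or_gt s p' with h0 | h0
        · have : (t - q) * (s - p') ≤ 0 :=
            mul_nonpos_of_nonneg_of_nonpos (by linarith) (by linarith)
          exact this.trans (by positivity)
        · calc (t - q) * (s - p') ≤ h * (s - p') :=
                mul_le_mul_of_nonneg_right htq (by linarith)
            _ ≤ _ := e5
      have e7 : (t - q) * (s - p') = (t - q) * s - p' * (t - q) := by ring
      linarith [e3.1, e3.2]
    have e1 := hsub q hqm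
    have e2 : (p - s) * (t - q) ≤ 2 / N * (2 * h) :=
      mul_le_mul hs2 (by linarith) (by linarith) (by positivity)
    have e3 : (p - s) * (t - q) = -(p * (q - t)) - (t - q) * s := by ring
    rw [hbN]
    linarith

lemma unitClass.mesh_mem_convexSeq (hab : a < b) (hφ : φ ∈ unitClass a b) {B N : ℕ} (hN : 1 ≤ N)
    (hB : 2 * (|a| + |b|) + 1 ≤ B) :
    (fun i : ℕ => (N : ℝ) ^ 2 * φ (a + i * ((b - a) / N))) ∈ convexSeq B N := by
  have hN0 : (0 : ℝ) < N := by exact_mod_cast hN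
  have hba : 0 < b - a := sub_pos.2 hab
  have hB1 : (1 : ℝ) ≤ B := by linarith [abs_nonneg a, abs_nonneg b]
  have hBab : b - a ≤ B := by linarith [abs_nonneg a, abs_nonneg b, neg_abs_le a, le_abs_self b]
  have hmem : ∀ i : ℕ, i ≤ N → a + i * ((b - a) / N) ∈ Icc a b := by
    intro i hi
    have hi' : (i : ℝ) ≤ N := by exact_mod_cast hi
    have h1 : i * ((b - a) / N) ≤ N * ((b - a) / N) := by gcongr
    have h2 : N * ((b - a) / N) = b - a := by field_simp
    have h3 : 0 ≤ i * ((b - a) / N) := by positivity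
    constructor <;> linarith
  refine ⟨?_, ?_, ?_⟩
  · rw [abs_mul, abs_of_pos (by positivity : (0 : ℝ) < (N : ℝ) ^ 2), mul_comm]
    gcongr
    exact ((hφ _ (hmem 0 (by omega))).1).trans hB1
  · intro i hi
    rw [← mul_sub, abs_mul, abs_of_pos (by positivity : (0 : ℝ) < (N : ℝ) ^ 2)]
    have h1 := unitClass.abs_sub_le hφ (hmem (i + 1) hi) (hmem i hi.le)
    have h2 : a + ((i + 1 : ℕ) : ℝ) * ((b - a) / N) - (a + i * ((b - a) / N)) = (b - a) / N := by
      push_cast; ring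
    rw [h2, abs_of_pos (div_pos hba hN0)] at h1
    calc _ ≤ (N : ℝ) ^ 2 * ((b - a) / N) := mul_le_mul_of_nonneg_left h1 (by positivity)
      _ = (b - a) * N := by field_simp
      _ ≤ _ := by gcongr
  · intro i hi
    obtain ⟨p, -, hp⟩ := (hφ _ (hmem (i + 1) hi.le)).2
    have h1 := hp _ (hmem i (by omega))
    have h2 := hp _ (hmem (i + 2) (by omega))
    have h3 : φ (a + (i + 1 : ℕ) * ((b - a) / N)) - φ (a + i * ((b - a) / N)) ≤
        φ (a + (i + 2 : ℕ) * ((b - a) / N)) - φ (a + (i + 1 : ℕ) * ((b - a) / N)) := by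
      push_cast at h1 h2 ⊢
      linarith
    dsimp only
    rw [← mul_sub, ← mul_sub]
    gcongr

lemma unitClass.conj_mem_convexSeq (hab : a < b) (hφ : φ ∈ unitClass a b) {B N : ℕ} (hN : 1 ≤ N)
    (hB : 2 * (|a| + |b|) + 1 ≤ B) :
    (fun i : ℕ => (N : ℝ) ^ 2 * conj a b φ (-1 + i * (2 / N))) ∈ convexSeq B N := by
  have hN0 : (0 : ℝ) < N := by exact_mod_cast hN
  have ha := abs_nonneg a
  have hb := abs_nonneg b
  have habs : ∀ u ∈ Icc a b, |u| ≤ |a| + |b| := by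
    intro u hu
    rw [abs_le]
    constructor <;> linarith [hu.1, hu.2, neg_abs_le a, le_abs_self b]
  refine ⟨?_, ?_, ?_⟩
  · rw [abs_mul, abs_of_pos (by positivity : (0 : ℝ) < (N : ℝ) ^ 2), mul_comm]
    gcongr
    obtain ⟨u, hu, h, -⟩ := unitClass.exists_conj_eq hab.le hφ (-1 + (0 : ℕ) * (2 / (N : ℝ)))
    rw [h]
    have h1 := (hφ u hu).1
    have h2 := habs u hu
    rw [abs_le] at h1 h2 ⊢
    push_cast
    constructor <;> linarith
  · intro i hi
    rw [← mul_sub, abs_mul, abs_of_pos (by positivity : (0 : ℝ) < (N : ℝ) ^ 2)]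
    obtain ⟨u, hu, h, h'⟩ := unitClass.exists_conj_eq hab.le hφ (-1 + i * (2 / (N : ℝ)))
    obtain ⟨v, hv, g, g'⟩ :=
      unitClass.exists_conj_eq hab.le hφ (-1 + (i + 1 : ℕ) * (2 / (N : ℝ)))
    have h1 := h' v hv
    have h2 := g' u hu
    have h3 := abs_le.1 (habs u hu)
    have h4 := abs_le.1 (habs v hv)
    have hN2 : 0 ≤ 2 / (N : ℝ) := by positivity
    have h5 := mul_le_mul_of_nonneg_right h3.1 hN2
    have h6 := mul_le_mul_of_nonneg_right h4.2 hN2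
    have h7 : |conj a b φ (-1 + (i + 1 : ℕ) * (2 / (N : ℝ))) - conj a b φ (-1 + i * (2 / (N : ℝ)))|
        ≤ (|a| + |b|) * (2 / N) := by
      rw [abs_le]
      push_cast at h1 h2 g ⊢
      constructor
      · linarith
      · linarith
    calc _ ≤ (N : ℝ) ^ 2 * ((|a| + |b|) * (2 / N)) := by gcongr
      _ = (2 * (|a| + |b|)) * N := by field_simp
      _ ≤ _ := by gcongr; linarith
  · intro i hi
    obtain ⟨u, hu, h, -⟩ := unitClass.exists_conj_eq hab.le hφ (-1 + (i + 1 : ℕ) * (2 / (N : ℝ)))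
    obtain ⟨-, -, -, h1⟩ := unitClass.exists_conj_eq hab.le hφ (-1 + i * (2 / (N : ℝ)))
    obtain ⟨-, -, -, h2⟩ := unitClass.exists_conj_eq hab.le hφ (-1 + (i + 2 : ℕ) * (2 / (N : ℝ)))
    have e1 := h1 u hu
    have e2 := h2 u hu
    dsimp only
    rw [← mul_sub, ← mul_sub]
    refine mul_le_mul_of_nonneg_left ?_ (by positivity)
    push_cast at h e1 e2 ⊢
    linarith

/-- The metric entropy of convex functions with bounded values and slopes: with `exp (O(N))`
labels the functions are determined up to `O(N⁻²)` in the supremum norm. -/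
lemma codable_unitClass (hab : a < b) : ∃ (A : ℕ) (C : ℝ), ∀ N : ℕ, 1 ≤ N →
    Codable (unitClass a b) (fun φ ψ => ∀ t ∈ Icc a b, |φ t - ψ t| ≤ C / (N : ℝ) ^ 2)
      (2 ^ (A * N)) := by
  obtain ⟨B, hB⟩ := exists_nat_ge (2 * (|a| + |b|) + 1)
  refine ⟨(4 * B + 10) + (4 * B + 10), 4 * (b - a) + 3, fun N hN => ?_⟩
  have hN0 : (0 : ℝ) < N := by exact_mod_cast hN
  have c1 := (codable_convexSeq B N hN).comap (S := unitClass a b)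
    (fun φ i => (N : ℝ) ^ 2 * φ (a + i * ((b - a) / N)))
    (fun φ hφ => unitClass.mesh_mem_convexSeq hab hφ hN hB)
  have c2 := (codable_convexSeq B N hN).comap (S := unitClass a b)
    (fun φ i => (N : ℝ) ^ 2 * conj a b φ (-1 + i * (2 / N)))
    (fun φ hφ => unitClass.conj_mem_convexSeq hab hφ hN hB)
  have hscale : ∀ x y : ℝ, |(N : ℝ) ^ 2 * x - (N : ℝ) ^ 2 * y| ≤ 1 → |x - y| ≤ 1 / (N : ℝ) ^ 2 := by
    intro x y h
    rw [← mul_sub, abs_mul, abs_of_pos (by positivity : (0 : ℝ) < (N : ℝ) ^ 2)] at h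
    rw [le_div_iff₀ (by positivity)]
    linarith
  refine (c1.inf c2).mono (by rw [← pow_add, add_mul (4 * B + 10)]) ?_
  rintro φ hφ ψ hψ ⟨h1, h2⟩ t ht
  have k1 := fun i hi => hscale _ _ (h1 i hi)
  have k2 := fun i hi => hscale _ _ (h2 i hi)
  have e1 := unitClass.le_add_of_mesh hab hφ hψ hN k1 k2 ht
  have e2 := unitClass.le_add_of_mesh hab hψ hφ hN
    (fun i hi => by rw [abs_sub_comm]; exact k1 i hi)
    (fun i hi => by rw [abs_sub_comm]; exact k2 i hi) ht
  rw [abs_le]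
  constructor <;> linarith

end ConvexSIM

/-! ### Exponential inequalities -/

namespace ConvexSIM

lemma exp_le_add_exp_sq (x : ℝ) : Real.exp x ≤ x + Real.exp (x ^ 2) := by
  have h2 := Real.add_one_le_exp (x ^ 2)
  rcases le_or_gt |x| 1 with h | h
  · have := (abs_le.1 (Real.abs_exp_sub_one_sub_id_le h)).2
    linarith
  · rcases le_or_gt 0 x with h0 | h0
    · rw [abs_of_nonneg h0] at h
      have : Real.exp x ≤ Real.exp (x ^ 2) := Real.exp_le_exp.2 (by nlinarith)
      linarith
    · rw [abs_of_neg h0] at h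
      have : Real.exp x ≤ 1 := Real.exp_le_one_iff.2 h0.le
      nlinarith

/-- A pointwise form of the sub-Gaussian bound: the coefficients `f a` and `g a ≥ 0` are bounded on
bounded sets, so that the right-hand side has conditional mean at most one if `z` is centred
and `K (exp (z² / K) - 1)` has conditional mean at most one. -/
lemma exists_exp_sub_sq_le {K : ℝ} (hK : 0 < K) : ∃ f g : ℝ → ℝ, Measurable f ∧ Measurable g ∧
    (∀ a, |f a| ≤ |a|) ∧ (∀ a, 0 ≤ g a ∧ g a ≤ a ^ 2 + 1 / (2 * K)) ∧
    ∀ a z, Real.exp (a * z - (1 + K / 2) * a ^ 2) ≤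
      1 + f a * z + g a * (K * (Real.exp (z ^ 2 / K) - 1) - 1) := by
  have hms : MeasurableSet {a : ℝ | a ^ 2 * K ≤ 1} := measurableSet_le (by fun_prop) (by fun_prop)
  have hexp : ∀ a : ℝ, Real.exp (-((1 + K / 2) * a ^ 2)) ≤ 1 := fun a =>
    Real.exp_le_one_iff.2 (by have : 0 ≤ (1 + K / 2) * a ^ 2 := by positivity
                              linarith)
  have hexp' : ∀ a : ℝ, Real.exp (-a ^ 2) ≤ 1 := fun a =>
    Real.exp_le_one_iff.2 (by have := sq_nonneg a; linarith)
  classical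
  refine ⟨fun a => if a ^ 2 * K ≤ 1 then a * Real.exp (-((1 + K / 2) * a ^ 2)) else 0,
    fun a => if a ^ 2 * K ≤ 1 then a ^ 2 * Real.exp (-((1 + K / 2) * a ^ 2))
      else 1 / (2 * K) * Real.exp (-a ^ 2),
    Measurable.ite hms (by fun_prop) (by fun_prop), Measurable.ite hms (by fun_prop) (by fun_prop),
    fun a => ?_, fun a => ?_, fun a z => ?_⟩
  · dsimp only
    split_ifs
    · rw [abs_mul, Real.abs_exp]
      exact mul_le_of_le_one_right (abs_nonneg _) (hexp a)
    · simp
  · have h1 : 0 ≤ 1 / (2 * K) := by positivity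
    have h2 := sq_nonneg a
    dsimp only
    split_ifs
    · refine ⟨by positivity, ?_⟩
      have := mul_le_of_le_one_right h2 (hexp a)
      linarith
    · refine ⟨by positivity, ?_⟩
      have := mul_le_of_le_one_right h1 (hexp' a)
      linarith
  · dsimp only
    have hsplit : Real.exp (a * z - (1 + K / 2) * a ^ 2) =
        Real.exp (a * z) * Real.exp (-((1 + K / 2) * a ^ 2)) := by
      rw [← Real.exp_add]; ring_nf
    split_ifs with h
    -- for small `a` the linear term is kept, so that centring is used
    · have h1 : Real.exp (a * z) ≤ a * z + Real.exp ((a * z) ^ 2) := exp_le_add_exp_sq _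
      have h2 : Real.exp ((a * z) ^ 2) ≤ 1 + a ^ 2 * K * (Real.exp (z ^ 2 / K) - 1) := by
        have := convexOn_exp.2 (mem_univ (z ^ 2 / K)) (mem_univ 0)
          (by positivity : 0 ≤ a ^ 2 * K) (by linarith : 0 ≤ 1 - a ^ 2 * K) (by ring)
        simp only [smul_eq_mul, mul_zero, add_zero, Real.exp_zero, mul_one] at this
        have e : a ^ 2 * K * (z ^ 2 / K) = (a * z) ^ 2 := by field_simp
        rw [e] at this
        linarith
      have h3 : (1 + a ^ 2) * Real.exp (-((1 + K / 2) * a ^ 2)) ≤ 1 := by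
        have h4 : 1 + a ^ 2 ≤ Real.exp (a ^ 2) := by
          have := Real.add_one_le_exp (a ^ 2); linarith
        calc _ ≤ Real.exp (a ^ 2) * Real.exp (-((1 + K / 2) * a ^ 2)) := by gcongr
          _ = Real.exp (-(K / 2 * a ^ 2)) := by rw [← Real.exp_add]; ring_nf
          _ ≤ 1 := Real.exp_le_one_iff.2 (by have : 0 ≤ K / 2 * a ^ 2 := by positivity
                                             linarith)
      have h5 : Real.exp (a * z) ≤
          (1 + a ^ 2) + a * z + a ^ 2 * (K * (Real.exp (z ^ 2 / K) - 1) - 1) := by linarith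
      rw [hsplit]
      have h6 := mul_le_mul_of_nonneg_right h5 (Real.exp_pos (-((1 + K / 2) * a ^ 2))).le
      linarith
    -- for large `a` Young's inequality suffices, and no centring is needed
    · have h1 : Real.exp (a * z) ≤
          Real.exp (a ^ 2 * K / 2) * (1 + (Real.exp (z ^ 2 / K) - 1) / 2) := by
        have e1 : a * z ≤ a ^ 2 * K / 2 + z ^ 2 / K / 2 := by
          have : 0 ≤ (a * K - z) ^ 2 / (2 * K) := by positivity
          have e : (a * K - z) ^ 2 / (2 * K) = a ^ 2 * K / 2 + z ^ 2 / K / 2 - a * z := by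
            field_simp; ring
          linarith
        have e2 : Real.exp (z ^ 2 / K / 2) ≤ 1 + (Real.exp (z ^ 2 / K) - 1) / 2 := by
          have e : Real.exp (z ^ 2 / K) = Real.exp (z ^ 2 / K / 2) ^ 2 := by
            rw [← Real.exp_nat_mul]; ring_nf
          rw [e]
          nlinarith [sq_nonneg (Real.exp (z ^ 2 / K / 2) - 1)]
        calc _ ≤ Real.exp (a ^ 2 * K / 2 + z ^ 2 / K / 2) := Real.exp_le_exp.2 e1
          _ = Real.exp (a ^ 2 * K / 2) * Real.exp (z ^ 2 / K / 2) := Real.exp_add _ _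
          _ ≤ _ := by gcongr
      have h2 : Real.exp (a * z - (1 + K / 2) * a ^ 2) ≤
          Real.exp (-a ^ 2) * (1 + (Real.exp (z ^ 2 / K) - 1) / 2) := by
        rw [hsplit]
        calc _ ≤ Real.exp (a ^ 2 * K / 2) * (1 + (Real.exp (z ^ 2 / K) - 1) / 2) *
              Real.exp (-((1 + K / 2) * a ^ 2)) := by gcongr
          _ = (Real.exp (a ^ 2 * K / 2) * Real.exp (-((1 + K / 2) * a ^ 2))) *
              (1 + (Real.exp (z ^ 2 / K) - 1) / 2) := by ring
          _ = _ := by rw [← Real.exp_add]; ring_nf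
      have h3 : Real.exp (-a ^ 2) * (1 + 1 / (2 * K)) ≤ 1 := by
        have e1 : 1 + 1 / (2 * K) ≤ Real.exp (a ^ 2) := by
          have e2 := Real.add_one_le_exp (a ^ 2)
          have e3 : 1 / (2 * K) ≤ a ^ 2 := by
            rw [div_le_iff₀ (by positivity)]
            nlinarith
          linarith
        calc _ ≤ Real.exp (-a ^ 2) * Real.exp (a ^ 2) := by gcongr
          _ = 1 := by rw [← Real.exp_add]; simp
      have h4 : Real.exp (-a ^ 2) * (1 + (Real.exp (z ^ 2 / K) - 1) / 2) =
          Real.exp (-a ^ 2) * (1 + 1 / (2 * K)) +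
          1 / (2 * K) * Real.exp (-a ^ 2) * (K * (Real.exp (z ^ 2 / K) - 1) - 1) := by
        field_simp; ring
      linarith

/-- The pull-out property of the conditional expectation, integrated. -/
lemma integral_mul_condExp {Ω : Type*} {m mΩ : MeasurableSpace Ω}
    {μ : Measure Ω} [IsProbabilityMeasure μ]
    (hm : m ≤ mΩ) {f g : Ω → ℝ}
    (hf : StronglyMeasurable[m] f) (hg : Integrable g μ) {c : ℝ} (hc : ∀ ω, |f ω| ≤ c) :
    ∫ ω, f ω * g ω ∂μ = ∫ ω, f ω * (μ[g | m]) ω ∂μ := by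
  have h := condExp_stronglyMeasurable_mul_of_bound hm hf hg c (ae_of_all μ hc)
  rw [← integral_condExp hm (f := fun ω => f ω * g ω)]
  exact integral_congr_ae h

section Probability

variable {Ω : Type*} [MeasurableSpace Ω] {μ : Measure Ω}

/-- The conditional Laplace transform bound for the errors, in a form which involves no conditional
expectation: for every bounded function `h` of the covariate, the exponential of the self-normalized
variable `e h(X) - C h(X)²` has expectation at most one. -/
lemma AssumptionA2.exists_lintegral_exp_le_one [IsProbabilityMeasure μ] {d : ℕ}
    {X : Ω → EuclideanSpace ℝ (Fin d)}
    (hX : Measurable X) {e : Ω → ℝ} (h2 : AssumptionA2 μ X e) :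
    ∃ C : ℝ, 0 < C ∧ ∀ h : EuclideanSpace ℝ (Fin d) → ℝ, Measurable h → ∀ B : ℝ, (∀ x, |h x| ≤ B) →
      ∫⁻ ω, ENNReal.ofReal (Real.exp (h (X ω) * e ω - C * h (X ω) ^ 2)) ∂μ ≤ 1 := by
  obtain ⟨he, hce, K, hK, hexp, hcexp⟩ := h2
  obtain ⟨f, g, hf, hg, hfb, hgb, hle⟩ := exists_exp_sub_sq_le hK
  refine ⟨1 + K / 2, by positivity, fun h hh B hB => ?_⟩
  have hm := hX.comap_le
  set mX := MeasurableSpace.comap X inferInstance with hmX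
  set W : Ω → ℝ := fun ω => Real.exp (e ω ^ 2 / K) - 1 with hW
  have hsm : ∀ k : ℝ → ℝ, Measurable k → StronglyMeasurable[mX] fun ω => k (h (X ω)) := by
    intro k hk
    exact ((hk.comp hh).comp (comap_measurable X)).stronglyMeasurable
  have hB0 : 0 ≤ B := by
    obtain ⟨ω⟩ : Nonempty Ω := nonempty_of_isProbabilityMeasure μ
    exact (abs_nonneg _).trans (hB (X ω))
  have hfB : ∀ ω, |f (h (X ω))| ≤ B := fun ω => (hfb _).trans (hB _)
  have hgB : ∀ ω, |g (h (X ω))| ≤ B ^ 2 + 1 / (2 * K) := fun ω => by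
    rw [abs_of_nonneg (hgb _).1]
    have : h (X ω) ^ 2 ≤ B ^ 2 := sq_le_sq' (abs_le.1 (hB _)).1 (abs_le.1 (hB _)).2
    linarith [(hgb (h (X ω))).2]
  have i1 : Integrable (fun ω => f (h (X ω)) * e ω) μ :=
    he.bdd_mul ((hsm f hf).mono hm).aestronglyMeasurable (ae_of_all _ hfB)
  have i3 : Integrable (fun ω => g (h (X ω))) μ :=
    (integrable_const (B ^ 2 + 1 / (2 * K))).mono' ((hsm g hg).mono hm).aestronglyMeasurable
      (ae_of_all _ hgB)
  have i2 : Integrable (fun ω => g (h (X ω)) * W ω) μ :=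
    hexp.bdd_mul ((hsm g hg).mono hm).aestronglyMeasurable (ae_of_all _ hgB)
  have e1 : ∫ ω, f (h (X ω)) * e ω ∂μ = 0 := by
    rw [integral_mul_condExp hm (hsm f hf) he hfB]
    rw [integral_congr_ae (g := fun _ => (0 : ℝ)), integral_zero]
    filter_upwards [hce] with ω hω
    rw [hω]; simp
  have e2 : K * ∫ ω, g (h (X ω)) * W ω ∂μ ≤ ∫ ω, g (h (X ω)) ∂μ := by
    rw [integral_mul_condExp hm (hsm g hg) hexp hgB, ← integral_const_mul]
    refine integral_mono_ae ?_ i3 ?_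
    · exact (integrable_condExp.bdd_mul ((hsm g hg).mono hm).aestronglyMeasurable
        (ae_of_all _ hgB)).const_mul K
    · filter_upwards [hcexp] with ω hω
      have := mul_le_mul_of_nonneg_left hω (hgb (h (X ω))).1
      linarith
  have i4 : Integrable (fun ω => 1 + f (h (X ω)) * e ω +
      (K * (g (h (X ω)) * W ω) - g (h (X ω)))) μ :=
    ((integrable_const 1).add i1).add ((i2.const_mul K).sub i3)
  have hpt : ∀ ω, Real.exp (h (X ω) * e ω - (1 + K / 2) * h (X ω) ^ 2) ≤
      1 + f (h (X ω)) * e ω + (K * (g (h (X ω)) * W ω) - g (h (X ω))) := fun ω => by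
    have := hle (h (X ω)) (e ω)
    simp only [hW]
    linarith
  calc _ ≤ ∫⁻ ω, ENNReal.ofReal (1 + f (h (X ω)) * e ω +
          (K * (g (h (X ω)) * W ω) - g (h (X ω)))) ∂μ :=
        lintegral_mono fun ω => ENNReal.ofReal_le_ofReal (hpt ω)
    _ = ENNReal.ofReal (∫ ω, (1 + f (h (X ω)) * e ω +
          (K * (g (h (X ω)) * W ω) - g (h (X ω)))) ∂μ) :=
        (ofReal_integral_eq_lintegral_ofReal i4
          (ae_of_all _ fun ω => (Real.exp_pos _).le.trans (hpt ω))).symm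
    _ ≤ 1 := by
        have s1 := integral_add ((integrable_const 1).add i1) ((i2.const_mul K).sub i3)
        have s2 := integral_add (integrable_const (1 : ℝ)) i1
        have s3 := integral_sub (i2.const_mul K) i3
        simp only [Pi.add_apply, Pi.sub_apply, integral_const_mul, e1, integral_const,
          probReal_univ, smul_eq_mul] at s1 s2 s3
        rw [s1, s2, s3, ← ENNReal.ofReal_one]
        refine ENNReal.ofReal_le_ofReal ?_
        linarith

variable {κ : Type*} [MeasurableSpace κ] {Z : ℕ → Ω → κ}

/-- Chernoff's bound for sums of independent copies of a variable `V` with `E exp V ≤ 1`. -/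
lemma measure_lt_sum_le (hZ : ∀ i, Measurable (Z i)) (hind : iIndepFun Z μ)
    (hid : ∀ i, IdentDistrib (Z i) (Z 0) μ μ) {V : κ → ℝ} (hV : Measurable V)
    (h1 : ∫⁻ ω, ENNReal.ofReal (Real.exp (V (Z 0 ω))) ∂μ ≤ 1) (n : ℕ) (t : ℝ) :
    μ {ω | t < ∑ i ∈ Finset.range n, V (Z i ω)} ≤ ENNReal.ofReal (Real.exp (-t)) := by
  have hmE : Measurable fun z => ENNReal.ofReal (Real.exp (V z)) := by fun_prop
  have hprod : ∫⁻ ω, ∏ i ∈ Finset.range n, ENNReal.ofReal (Real.exp (V (Z i ω))) ∂μ ≤ 1 := by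
    rw [lintegral_prod_eq_prod_lintegral_of_indepFun (Finset.range n)
      (fun i ω => ENNReal.ofReal (Real.exp (V (Z i ω)))) (hind.comp _ fun _ => hmE)
      fun i => hmE.comp (hZ i)]
    refine Finset.prod_le_one' fun i _ => ?_
    exact ((hid i).comp hmE).lintegral_eq.trans_le h1
  have hM : Measurable fun ω => ∏ i ∈ Finset.range n, ENNReal.ofReal (Real.exp (V (Z i ω))) :=
    Finset.measurable_prod _ fun i _ => hmE.comp (hZ i)
  have hmk := meas_ge_le_lintegral_div (μ := μ) hM.aemeasurable
    (ε := ENNReal.ofReal (Real.exp t)) (by simp [Real.exp_pos]) ENNReal.ofReal_ne_top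
  calc _ ≤ μ {ω | ENNReal.ofReal (Real.exp t) ≤
        ∏ i ∈ Finset.range n, ENNReal.ofReal (Real.exp (V (Z i ω)))} := by
        refine measure_mono fun ω hω => ?_
        change ENNReal.ofReal (Real.exp t) ≤
          ∏ i ∈ Finset.range n, ENNReal.ofReal (Real.exp (V (Z i ω)))
        replace hω : t < ∑ i ∈ Finset.range n, V (Z i ω) := hω
        rw [← ENNReal.ofReal_prod_of_nonneg fun _ _ => (Real.exp_pos _).le, ← Real.exp_sum]
        exact ENNReal.ofReal_le_ofReal (Real.exp_le_exp.2 hω.le)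
    _ ≤ _ := hmk
    _ ≤ 1 / ENNReal.ofReal (Real.exp t) := by gcongr
    _ = _ := by
        rw [one_div, ← ENNReal.ofReal_inv_of_pos (Real.exp_pos _), Real.exp_neg]

/-- The union of the bounds of `measure_lt_sum_le` over a family of at most `2 ^ k` functions. -/
lemma measure_exists_lt_sum_le (hZ : ∀ i, Measurable (Z i)) (hind : iIndepFun Z μ)
    (hid : ∀ i, IdentDistrib (Z i) (Z 0) μ μ) {ι : Type*} (T : Finset ι) {k : ℕ}
    (hT : T.card ≤ 2 ^ k) {V : ι → κ → ℝ} (hV : ∀ p ∈ T, Measurable (V p))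
    (h1 : ∀ p ∈ T, ∫⁻ ω, ENNReal.ofReal (Real.exp (V p (Z 0 ω))) ∂μ ≤ 1) (n : ℕ) (t : ℝ) :
    μ {ω | ∃ p ∈ T, k + t < ∑ i ∈ Finset.range n, V p (Z i ω)} ≤
      ENNReal.ofReal (Real.exp (-t)) := by
  have e : {ω | ∃ p ∈ T, k + t < ∑ i ∈ Finset.range n, V p (Z i ω)} =
      ⋃ p ∈ T, {ω | k + t < ∑ i ∈ Finset.range n, V p (Z i ω)} := by ext; simp
  rw [e]
  calc _ ≤ ∑ p ∈ T, μ {ω | k + t < ∑ i ∈ Finset.range n, V p (Z i ω)} :=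
        measure_biUnion_finset_le _ _
    _ ≤ ∑ p ∈ T, ENNReal.ofReal (Real.exp (-(k + t))) :=
        Finset.sum_le_sum fun p hp => measure_lt_sum_le hZ hind hid (hV p hp) (h1 p hp) n _
    _ = ENNReal.ofReal (T.card * Real.exp (-(k + t))) := by
        rw [Finset.sum_const, nsmul_eq_mul, ENNReal.ofReal_mul (by positivity),
          ENNReal.ofReal_natCast]
    _ ≤ _ := by
        refine ENNReal.ofReal_le_ofReal ?_
        have h2 : (T.card : ℝ) ≤ Real.exp k := by
          calc (T.card : ℝ) ≤ 2 ^ k := by exact_mod_cast hT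
            _ ≤ Real.exp 1 ^ k := by
                gcongr
                have := Real.add_one_le_exp (1 : ℝ); linarith
            _ = Real.exp k := by rw [← Real.exp_nat_mul, mul_one]
        calc T.card * Real.exp (-(k + t)) ≤ Real.exp k * Real.exp (-(k + t)) := by gcongr
          _ = _ := by rw [← Real.exp_add]; ring_nf

end Probability

end ConvexSIM

/-! ### Empirical processes over classes with the entropy of convex functions -/

namespace ConvexSIM

section EmpiricalProcess

variable {Ω : Type*} [MeasurableSpace Ω] {μ : Measure Ω}
  {E : Type*} [MeasurableSpace E] {β : Type*} {S : Set β} {G : β → E → ℝ} {χ : Set E} {A : ℕ}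
  {C : ℝ}

/-- The functions `G p`, `p ∈ S`, are measurable, bounded by two, and for every `N` determined on
`χ` up to an error `C N⁻²` by a code with `2 ^ (A N)` labels: their `δ`-entropy is `O(δ ^ (-1/2))`,
as for convex functions of one variable. -/
structure HasConvexEntropy (S : Set β) (G : β → E → ℝ) (χ : Set E) (A : ℕ) (C : ℝ) : Prop where
  nonneg : 0 ≤ C
  measurable : ∀ p ∈ S, Measurable (G p)
  abs_le : ∀ p ∈ S, ∀ x, |G p x| ≤ 2
  codable : ∀ N : ℕ, 1 ≤ N →
    Codable S (fun p q => ∀ x ∈ χ, |G p x - G q x| ≤ C / (N : ℝ) ^ 2) (2 ^ (A * N))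

lemma HasConvexEntropy.exists_net (h : HasConvexEntropy S G χ A C) :
    ∃ (T : ℕ → Finset β) (π : ℕ → β → β), (∀ K, (T K).card ≤ 2 ^ (A * 2 ^ K)) ∧
      (∀ K, ∀ p ∈ S, π K p ∈ T K) ∧ (∀ K, ∀ p ∈ T K, p ∈ S) ∧
      ∀ K, ∀ p ∈ S, ∀ x ∈ χ, |G p x - G (π K p) x| ≤ C / 4 ^ K := by
  choose T π h1 h2 h3 h4 using fun K => (h.codable (2 ^ K) Nat.one_le_two_pow).exists_net
  refine ⟨T, π, h1, h2, h3, fun K p hp x hx => ?_⟩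
  have e : (((2 ^ K : ℕ) : ℝ)) ^ 2 = 4 ^ K := by
    push_cast; rw [← pow_mul, mul_comm, pow_mul]; norm_num
  have := h4 K p hp x hx
  rwa [e] at this

lemma exp_neg_two_pow_le (K : ℕ) : Real.exp (-2 ^ K) ≤ 1 / 2 ^ K := by
  rw [Real.exp_neg, one_div]
  have := Real.add_one_le_exp ((2 : ℝ) ^ K)
  gcongr
  linarith

lemma sum_sq_le_of_abs_sub_le {n : ℕ} {f g : ℕ → ℝ} {δ : ℝ}
    (h : ∀ i ∈ Finset.range n, |f i - g i| ≤ δ) :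
    ∑ i ∈ Finset.range n, f i ^ 2 ≤ 2 * ∑ i ∈ Finset.range n, g i ^ 2 + 2 * (n * δ ^ 2) := by
  have : ∀ i ∈ Finset.range n, f i ^ 2 ≤ 2 * g i ^ 2 + 2 * δ ^ 2 := by
    intro i hi
    have h1 : (f i - g i) ^ 2 ≤ δ ^ 2 := sq_le_sq' (abs_le.1 (h i hi)).1 (abs_le.1 (h i hi)).2
    nlinarith [sq_nonneg (f i - 2 * g i)]
  calc _ ≤ ∑ i ∈ Finset.range n, (2 * g i ^ 2 + 2 * δ ^ 2) := Finset.sum_le_sum this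
    _ = _ := by
      rw [Finset.sum_add_distrib, ← Finset.mul_sum, Finset.sum_const, Finset.card_range,
        nsmul_eq_mul]
      ring

variable {X : ℕ → Ω → E} {e : ℕ → Ω → ℝ} {c : ℝ}

/-- Simultaneous self-normalized deviation bounds for at most `2 ^ k` functions. The factor `u` is
at disposal; no bound on the size of the functions enters. -/
lemma measure_exists_lt_sum_mul_le (hX : ∀ i, Measurable (X i)) (he : ∀ i, Measurable (e i))
    (hind : iIndepFun (fun i ω => (X i ω, e i ω)) μ)
    (hid : ∀ i, IdentDistrib (fun ω => (X i ω, e i ω)) (fun ω => (X 0 ω, e 0 ω)) μ μ)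
    (hc : ∀ h : E → ℝ, Measurable h → ∀ B : ℝ, (∀ x, |h x| ≤ B) →
      ∫⁻ ω, ENNReal.ofReal (Real.exp (h (X 0 ω) * e 0 ω - c * h (X 0 ω) ^ 2)) ∂μ ≤ 1)
    {ι : Type*} (T : Finset ι) {k : ℕ} (hT : T.card ≤ 2 ^ k) {H : ι → E → ℝ}
    (hH : ∀ p ∈ T, Measurable (H p)) {B : ℝ} (hB : ∀ p ∈ T, ∀ x, |H p x| ≤ B) {u : ℝ} (hu : 0 < u)
    (n : ℕ) (t : ℝ) :
    μ {ω | ∃ p ∈ T, c * u * ∑ i ∈ Finset.range n, H p (X i ω) ^ 2 + (k + t) / u <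
      ∑ i ∈ Finset.range n, e i ω * H p (X i ω)} ≤ ENNReal.ofReal (Real.exp (-t)) := by
  refine le_trans (measure_mono ?_) (measure_exists_lt_sum_le (fun i => (hX i).prodMk (he i))
    hind hid T hT (V := fun p z => u * H p z.1 * z.2 - c * (u * H p z.1) ^ 2) ?_ ?_ n t)
  · rintro ω ⟨p, hp, h⟩
    refine ⟨p, hp, ?_⟩
    have e1 : ∑ i ∈ Finset.range n,
        (u * H p (X i ω) * e i ω - c * (u * H p (X i ω)) ^ 2) =
        u * (∑ i ∈ Finset.range n, e i ω * H p (X i ω) -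
          c * u * ∑ i ∈ Finset.range n, H p (X i ω) ^ 2) := by
      rw [mul_sub, Finset.mul_sum, Finset.mul_sum, Finset.mul_sum, ← Finset.sum_sub_distrib]
      exact Finset.sum_congr rfl fun i _ => by ring
    have e2 : (k + t) / u < ∑ i ∈ Finset.range n, e i ω * H p (X i ω) -
        c * u * ∑ i ∈ Finset.range n, H p (X i ω) ^ 2 := by linarith
    rw [div_lt_iff₀ hu] at e2
    simp only
    rw [e1, mul_comm]
    exact e2
  · intro p hp
    have := hH p hp
    fun_prop
  · intro p hp
    refine hc (fun x => u * H p x) ((hH p hp).const_mul u) (u * B) fun x => ?_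
    rw [abs_mul, abs_of_pos hu]
    exact mul_le_mul_of_nonneg_left (hB p hp x) hu.le

set_option maxHeartbeats 800000 in
/-- The multiplier process of the errors over the class, with the sample size between two
consecutive powers of `32`. The chain of approximations at the resolutions `4⁻ᴷ`, `k ≤ K < 2k`,
contributes terms which decrease geometrically from `2ᵏ`, which is the order of `n ^ (1/5)`. -/
lemma exists_measure_multiplier_le (hG : HasConvexEntropy S G χ A C)
    (hX : ∀ i, Measurable (X i)) (he : ∀ i, Measurable (e i))
    (hind : iIndepFun (fun i ω => (X i ω, e i ω)) μ)
    (hid : ∀ i, IdentDistrib (fun ω => (X i ω, e i ω)) (fun ω => (X 0 ω, e 0 ω)) μ μ)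
    (hχ : ∀ᵐ ω ∂μ, ∀ i, X i ω ∈ χ) (hc0 : 0 < c)
    (hc : ∀ h : E → ℝ, Measurable h → ∀ B : ℝ, (∀ x, |h x| ≤ B) →
      ∫⁻ ω, ENNReal.ofReal (Real.exp (h (X 0 ω) * e 0 ω - c * h (X 0 ω) ^ 2)) ∂μ ≤ 1)
    {s : ℝ} (hs : 0 < s) :
    ∃ D : ℝ, 0 ≤ D ∧ ∀ (n k : ℕ) (L : ℝ), 0 < L → 1 ≤ n → n ≤ 32 * 32 ^ k →
      μ {ω | ∃ p ∈ S, s * ∑ i ∈ Finset.range n, G p (X i ω) ^ 2 + D * (1 + L) * 2 ^ k <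
        ∑ i ∈ Finset.range n, e i ω * G p (X i ω)} ≤
      ENNReal.ofReal (3 / 2 ^ k) + (∫⁻ ω, ‖e 0 ω‖ₑ ∂μ) / ENNReal.ofReal L := by
  obtain ⟨T, π, hcard, hπ, hTS, happ⟩ := hG.exists_net
  have hC := hG.nonneg
  set D₀ : ℝ := 128 * c * C ^ 2 + 3 * A + 1 with hD₀
  have hD₀0 : 0 ≤ D₀ := by positivity
  refine ⟨32 * s * C ^ 2 + (A + 1) * (2 * c / s) + 2 * D₀ + 32 * C, by positivity,
    fun n k L hL hn hnk => ?_⟩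
  set a : Ω → β → ℝ := fun ω p => ∑ i ∈ Finset.range n, e i ω * G p (X i ω) with ha
  have hnk' : (n : ℝ) / 16 ^ k ≤ 32 * 2 ^ k := by
    rw [div_le_iff₀ (by positivity), mul_assoc, ← mul_pow]
    norm_num
    exact_mod_cast hnk
  -- the exceptional events: the net at resolution `4⁻ᵏ`, where `u = s / (2c)` leaves half of the
  -- quadratic term for the approximation error; the links of the chain, where `u = 4ʲ` balances the
  -- quadratic term against the entropy; and large mean absolute errors, for the last remainder
  let B0 : Set Ω := {ω | ∃ p ∈ T k, c * (s / (2 * c)) * ∑ i ∈ Finset.range n, G p (X i ω) ^ 2 +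
    ((A * 2 ^ k : ℕ) + 2 ^ k) / (s / (2 * c)) < ∑ i ∈ Finset.range n, e i ω * G p (X i ω)}
  let H : β × β → E → ℝ := fun p x => G p.1 x - G p.2 x
  let BL : ℕ → Set Ω := fun j => {ω | ∃ p ∈ T (k + j + 1) ×ˢ T (k + j),
    c * 4 ^ j * ∑ i ∈ Finset.range n, H p (X i ω) ^ 2 +
    ((3 * A * 2 ^ (k + j) : ℕ) + 2 ^ (k + j)) / 4 ^ j <
      ∑ i ∈ Finset.range n, e i ω * H p (X i ω)}
  let BR : Set Ω := {ω | ENNReal.ofReal (n * L) ≤ ∑ i ∈ Finset.range n, ‖e i ω‖ₑ}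
  have m0 : μ B0 ≤ ENNReal.ofReal (1 / 2 ^ k) :=
    (measure_exists_lt_sum_mul_le hX he hind hid hc (T k) (hcard k)
      (fun p hp => hG.measurable p (hTS k p hp)) (fun p hp => hG.abs_le p (hTS k p hp))
      (by positivity) n _).trans (ENNReal.ofReal_le_ofReal (exp_neg_two_pow_le k))
  have mL : ∀ j, μ (BL j) ≤ ENNReal.ofReal (1 / 2 ^ (k + j)) := by
    intro j
    refine (measure_exists_lt_sum_mul_le hX he hind hid hc (T (k + j + 1) ×ˢ T (k + j)) ?_ (H := H)
      (B := 4) ?_ ?_ (by positivity) n _).trans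
      (ENNReal.ofReal_le_ofReal (exp_neg_two_pow_le (k + j)))
    · rw [Finset.card_product]
      calc _ ≤ 2 ^ (A * 2 ^ (k + j + 1)) * 2 ^ (A * 2 ^ (k + j)) :=
            Nat.mul_le_mul (hcard _) (hcard _)
        _ = _ := by rw [← pow_add]; congr 1; ring
    · intro p hp
      rw [Finset.mem_product] at hp
      exact (hG.measurable _ (hTS _ _ hp.1)).sub (hG.measurable _ (hTS _ _ hp.2))
    · intro p hp x
      rw [Finset.mem_product] at hp
      have h1 := hG.abs_le _ (hTS _ _ hp.1) x
      have h2 := hG.abs_le _ (hTS _ _ hp.2) x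
      calc |H p x| ≤ |G p.1 x| + |G p.2 x| := abs_sub _ _
        _ ≤ 4 := by linarith
  have mR : μ BR ≤ (∫⁻ ω, ‖e 0 ω‖ₑ ∂μ) / ENNReal.ofReal L := by
    have hn0 : (0 : ℝ) < n := by exact_mod_cast hn
    have hm : Measurable fun ω => ∑ i ∈ Finset.range n, ‖e i ω‖ₑ :=
      Finset.measurable_sum _ fun i _ => (he i).enorm
    refine (meas_ge_le_lintegral_div hm.aemeasurable
      (ENNReal.ofReal_pos.2 (mul_pos hn0 hL)).ne' ENNReal.ofReal_ne_top).trans ?_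
    rw [lintegral_finsetSum _ fun i _ => (he i).enorm]
    have : ∀ i ∈ Finset.range n, ∫⁻ ω, ‖e i ω‖ₑ ∂μ = ∫⁻ ω, ‖e 0 ω‖ₑ ∂μ := fun i _ =>
      ((hid i).comp (u := fun z : E × ℝ => ‖z.2‖ₑ) (by fun_prop)).lintegral_eq
    rw [Finset.sum_congr rfl this, Finset.sum_const, Finset.card_range, nsmul_eq_mul,
      ENNReal.ofReal_mul hn0.le, ENNReal.ofReal_natCast,
      ENNReal.mul_div_mul_left _ _ (by exact_mod_cast (by omega : n ≠ 0))
        (ENNReal.natCast_ne_top n)]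
  have hsub : {ω | ∃ p ∈ S, s * ∑ i ∈ Finset.range n, G p (X i ω) ^ 2 +
      (32 * s * C ^ 2 + (A + 1) * (2 * c / s) + 2 * D₀ + 32 * C) * (1 + L) * 2 ^ k <
        ∑ i ∈ Finset.range n, e i ω * G p (X i ω)} ⊆
      {ω | ¬ ∀ i, X i ω ∈ χ} ∪ (B0 ∪ ((⋃ j ∈ Finset.range k, BL j) ∪ BR)) := by
    rintro ω ⟨p, hp, hlt⟩
    by_contra hω
    simp only [mem_union, mem_iUnion, not_or, not_exists] at hω
    obtain ⟨h1, h2, h3, h4⟩ := hω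
    replace h1 : ∀ i, X i ω ∈ χ := not_not.1 h1
    -- the coarsest approximation
    have b0 : a ω (π k p) ≤ s * ∑ i ∈ Finset.range n, G p (X i ω) ^ 2 +
        (32 * s * C ^ 2 + (A + 1) * (2 * c / s)) * 2 ^ k := by
      have e1 : a ω (π k p) ≤
          c * (s / (2 * c)) * ∑ i ∈ Finset.range n, G (π k p) (X i ω) ^ 2 +
          ((A * 2 ^ k : ℕ) + 2 ^ k) / (s / (2 * c)) := by
        by_contra hcon
        exact h2 ⟨_, hπ k p hp, not_le.1 hcon⟩
      have e2 := sum_sq_le_of_abs_sub_le (n := n) (f := fun i => G (π k p) (X i ω))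
        (g := fun i => G p (X i ω)) (δ := C / 4 ^ k)
        fun i _ => by rw [abs_sub_comm]; exact happ k p hp _ (h1 i)
      have e3 : c * (s / (2 * c)) = s / 2 := by field_simp
      have e4 : (n : ℝ) * (C / 4 ^ k) ^ 2 ≤ 32 * 2 ^ k * C ^ 2 := by
        have : (n : ℝ) * (C / 4 ^ k) ^ 2 = n / 16 ^ k * C ^ 2 := by
          rw [div_pow, ← pow_mul, mul_comm k 2, pow_mul]; norm_num; ring
        rw [this]; gcongr
      have e5 : (((A * 2 ^ k : ℕ) : ℝ) + 2 ^ k) / (s / (2 * c)) =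
          (A + 1) * (2 * c / s) * 2 ^ k := by push_cast; field_simp
      rw [e3, e5] at e1
      have e6 : s / 2 * ∑ i ∈ Finset.range n, G (π k p) (X i ω) ^ 2 ≤
          s / 2 * (2 * ∑ i ∈ Finset.range n, G p (X i ω) ^ 2 + 2 * (32 * 2 ^ k * C ^ 2)) := by
        gcongr
        linarith
      linarith
    -- the links of the chain
    have bL : ∀ j ∈ Finset.range k, a ω (π (k + (j + 1)) p) - a ω (π (k + j) p) ≤
        D₀ * 2 ^ k * (1 / 2) ^ j := by
      intro j hj
      have e1 : a ω (π (k + j + 1) p) - a ω (π (k + j) p) ≤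
          c * 4 ^ j * ∑ i ∈ Finset.range n,
            H (π (k + j + 1) p, π (k + j) p) (X i ω) ^ 2 +
          ((3 * A * 2 ^ (k + j) : ℕ) + 2 ^ (k + j)) / 4 ^ j := by
        by_contra hcon
        refine h3 j hj ⟨(π (k + j + 1) p, π (k + j) p),
          Finset.mem_product.2 ⟨hπ _ p hp, hπ _ p hp⟩, ?_⟩
        have e0 : ∑ i ∈ Finset.range n, e i ω * H (π (k + j + 1) p, π (k + j) p) (X i ω) =
            a ω (π (k + j + 1) p) - a ω (π (k + j) p) := by
          simp only [H, ha, mul_sub, Finset.sum_sub_distrib]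
        rw [e0]
        exact not_le.1 hcon
      have e2 : ∀ i, |H (π (k + j + 1) p, π (k + j) p) (X i ω)| ≤ 2 * C / 4 ^ (k + j) := by
        intro i
        have g1 := happ (k + j + 1) p hp _ (h1 i)
        have g2 := happ (k + j) p hp _ (h1 i)
        have g3 : C / 4 ^ (k + j + 1) ≤ C / 4 ^ (k + j) :=
          div_le_div_of_nonneg_left hC (by positivity)
            (pow_le_pow_right₀ (by norm_num) (by omega))
        rw [abs_le] at g1 g2 ⊢
        have g4 : 2 * C / 4 ^ (k + j) = C / 4 ^ (k + j) + C / 4 ^ (k + j) := by ring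
        simp only [H]
        rw [g4]
        constructor <;> linarith [g1.1, g1.2, g2.1, g2.2]
      have e3 : ∑ i ∈ Finset.range n, H (π (k + j + 1) p, π (k + j) p) (X i ω) ^ 2 ≤
          n * (2 * C / 4 ^ (k + j)) ^ 2 := by
        have : ∀ i ∈ Finset.range n, H (π (k + j + 1) p, π (k + j) p) (X i ω) ^ 2 ≤
            (2 * C / 4 ^ (k + j)) ^ 2 := fun i _ =>
          sq_le_sq' (abs_le.1 (e2 i)).1 (abs_le.1 (e2 i)).2
        refine (Finset.sum_le_sum this).trans ?_
        rw [Finset.sum_const, Finset.card_range, nsmul_eq_mul]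
      have e4 : c * 4 ^ j * (n * (2 * C / 4 ^ (k + j)) ^ 2) ≤
          128 * c * C ^ 2 * 2 ^ k * (1 / 2) ^ j := by
        have g1 : c * 4 ^ j * (n * (2 * C / 4 ^ (k + j)) ^ 2) =
            4 * c * C ^ 2 * (n / 16 ^ k) * (1 / 4) ^ j := by
          have : (16 : ℝ) ^ k = 4 ^ k * 4 ^ k := by rw [← mul_pow]; norm_num
          rw [this, one_div, inv_pow, pow_add]
          field_simp
          ring
        have g2 : ((1 : ℝ) / 4) ^ j ≤ (1 / 2) ^ j := by
          gcongr
          norm_num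
        rw [g1]
        calc _ ≤ 4 * c * C ^ 2 * (32 * 2 ^ k) * (1 / 2) ^ j := by gcongr
          _ = _ := by ring
      have e5 : (((3 * A * 2 ^ (k + j) : ℕ) : ℝ) + 2 ^ (k + j)) / 4 ^ j =
          (3 * A + 1) * 2 ^ k * (1 / 2) ^ j := by
        have : (4 : ℝ) = 2 * 2 := by norm_num
        rw [this, mul_pow, one_div, inv_pow]
        push_cast
        rw [pow_add]
        field_simp
      rw [e5] at e1
      have e6 : c * 4 ^ j * ∑ i ∈ Finset.range n, H (π (k + j + 1) p, π (k + j) p) (X i ω) ^ 2 ≤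
          c * 4 ^ j * (n * (2 * C / 4 ^ (k + j)) ^ 2) := by gcongr
      have e7 : D₀ * 2 ^ k * (1 / 2) ^ j = 128 * c * C ^ 2 * 2 ^ k * (1 / 2) ^ j +
          (3 * A + 1) * 2 ^ k * (1 / 2) ^ j := by rw [hD₀]; ring
      rw [e7]
      exact e1.trans (by linarith)
    have bS : a ω (π (k + k) p) - a ω (π k p) ≤ 2 * D₀ * 2 ^ k := by
      have e1 := Finset.sum_le_sum bL
      rw [Finset.sum_range_sub (fun j => a ω (π (k + j) p)), ← Finset.mul_sum] at e1
      have e2 : ∑ j ∈ Finset.range k, ((1 : ℝ) / 2) ^ j ≤ 2 := by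
        rw [geom_sum_eq (by norm_num)]
        have : (0 : ℝ) ≤ (1 / 2) ^ k := by positivity
        rw [div_le_iff_of_neg (by norm_num)]
        linarith
      have e3 : D₀ * 2 ^ k * ∑ j ∈ Finset.range k, ((1 : ℝ) / 2) ^ j ≤ D₀ * 2 ^ k * 2 := by gcongr
      simp only [add_zero] at e1
      linarith
    -- the error of the finest approximation
    have bR : a ω p - a ω (π (k + k) p) ≤ 32 * C * L * 2 ^ k := by
      have e1 : ∑ i ∈ Finset.range n, |e i ω| ≤ n * L := by
        have h4' : ∑ i ∈ Finset.range n, ‖e i ω‖ₑ < ENNReal.ofReal (n * L) := not_le.1 h4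
        have : ∑ i ∈ Finset.range n, ‖e i ω‖ₑ =
            ENNReal.ofReal (∑ i ∈ Finset.range n, |e i ω|) := by
          rw [ENNReal.ofReal_sum_of_nonneg fun _ _ => abs_nonneg _]
          exact Finset.sum_congr rfl fun i _ => by rw [← Real.norm_eq_abs, ofReal_norm]
        rw [this] at h4'
        exact ((ENNReal.ofReal_lt_ofReal_iff_of_nonneg
          (Finset.sum_nonneg fun _ _ => abs_nonneg _)).1 h4').le
      have e2 : a ω p - a ω (π (k + k) p) ≤
          (∑ i ∈ Finset.range n, |e i ω|) * (C / 4 ^ (k + k)) := by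
        simp only [ha]
        rw [← Finset.sum_sub_distrib, Finset.sum_mul]
        refine Finset.sum_le_sum fun i _ => ?_
        rw [← mul_sub]
        refine (le_abs_self _).trans ?_
        rw [abs_mul]
        exact mul_le_mul_of_nonneg_left (happ (k + k) p hp _ (h1 i)) (abs_nonneg _)
      have e3 : (n : ℝ) * L * (C / 4 ^ (k + k)) = n / 16 ^ k * (C * L) := by
        have : (16 : ℝ) = 4 * 4 := by norm_num
        rw [this, mul_pow, pow_add]; field_simp
      calc _ ≤ (n : ℝ) * L * (C / 4 ^ (k + k)) := e2.trans (by gcongr)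
        _ = n / 16 ^ k * (C * L) := e3
        _ ≤ 32 * 2 ^ k * (C * L) := by gcongr
        _ = _ := by ring
    have hfin : (32 * s * C ^ 2 + (A + 1) * (2 * c / s) + 2 * D₀) * 2 ^ k + 32 * C * L * 2 ^ k ≤
        (32 * s * C ^ 2 + (A + 1) * (2 * c / s) + 2 * D₀ + 32 * C) * (1 + L) * 2 ^ k := by
      have : 0 ≤ (32 * s * C ^ 2 + (A + 1) * (2 * c / s) + 2 * D₀) * L * 2 ^ k +
        32 * C * 2 ^ k := by positivity
      linarith
    have hlt' : s * ∑ i ∈ Finset.range n, G p (X i ω) ^ 2 +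
      (32 * s * C ^ 2 + (A + 1) * (2 * c / s) + 2 * D₀ + 32 * C) * (1 + L) * 2 ^ k < a ω p := hlt
    linarith
  have hnull : μ {ω | ¬ ∀ i, X i ω ∈ χ} = 0 := hχ
  have mU : μ (⋃ j ∈ Finset.range k, BL j) ≤ ENNReal.ofReal (2 / 2 ^ k) := by
    refine (measure_biUnion_finset_le _ _).trans ((Finset.sum_le_sum fun j _ => mL j).trans ?_)
    rw [← ENNReal.ofReal_sum_of_nonneg fun _ _ => by positivity]
    refine ENNReal.ofReal_le_ofReal ?_
    have e1 : ∀ j ∈ Finset.range k, (1 : ℝ) / 2 ^ (k + j) = 1 / 2 ^ k * (1 / 2) ^ j := by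
      intro j _
      rw [pow_add, one_div_pow]; field_simp
    rw [Finset.sum_congr rfl e1, ← Finset.mul_sum]
    have e2 : ∑ j ∈ Finset.range k, ((1 : ℝ) / 2) ^ j ≤ 2 := by
      rw [geom_sum_eq (by norm_num)]
      have : (0 : ℝ) ≤ (1 / 2) ^ k := by positivity
      rw [div_le_iff_of_neg (by norm_num)]
      linarith
    calc _ ≤ (1 : ℝ) / 2 ^ k * 2 := by gcongr
      _ = _ := by ring
  calc _ ≤ μ ({ω | ¬ ∀ i, X i ω ∈ χ} ∪ (B0 ∪ ((⋃ j ∈ Finset.range k, BL j) ∪ BR))) :=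
        measure_mono hsub
    _ ≤ μ {ω | ¬ ∀ i, X i ω ∈ χ} + (μ B0 + (μ (⋃ j ∈ Finset.range k, BL j) + μ BR)) := by
        refine (measure_union_le _ _).trans (add_le_add_right ?_ _)
        refine (measure_union_le _ _).trans (add_le_add_right ?_ _)
        exact measure_union_le _ _
    _ ≤ 0 + (ENNReal.ofReal (1 / 2 ^ k) + (ENNReal.ofReal (2 / 2 ^ k) +
          (∫⁻ ω, ‖e 0 ω‖ₑ ∂μ) / ENNReal.ofReal L)) := by
        gcongr
        exact hnull.le
    _ = _ := by
        rw [zero_add, ← add_assoc, ← ENNReal.ofReal_add (by positivity) (by positivity)]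
        congr 2
        ring

end EmpiricalProcess

end ConvexSIM

namespace ConvexSIM

section NormComparison

variable {Ω : Type*} [MeasurableSpace Ω] {μ : Measure Ω}
  {E : Type*} [MeasurableSpace E] {β : Type*} {S : Set β} {G : β → E → ℝ} {χ : Set E} {A : ℕ}
  {C : ℝ}

/-- An exponential inequality for the lower tail of a bounded nonnegative variable, which needs no
variance. -/
lemma lintegral_exp_sub_sq_le_one {P : Measure E} [IsProbabilityMeasure P] {g : E → ℝ}
    (hg : Measurable g) (hb : ∀ x, |g x| ≤ 2) :
    ∫⁻ x, ENNReal.ofReal (Real.exp ((∫ x, g x ^ 2 ∂P) / 8 - g x ^ 2 / 4)) ∂P ≤ 1 := by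
  set I := ∫ x, g x ^ 2 ∂P with hI
  have hb2 : ∀ x, g x ^ 2 ≤ 4 := fun x => by
    have := sq_le_sq' (abs_le.1 (hb x)).1 (abs_le.1 (hb x)).2
    linarith
  have hint : Integrable (fun x => g x ^ 2) P :=
    (integrable_const (4 : ℝ)).mono' (hg.pow_const 2).aestronglyMeasurable
      (ae_of_all _ fun x => by rw [Real.norm_eq_abs, abs_of_nonneg (sq_nonneg _)]; exact hb2 x)
  have hpt : ∀ x, Real.exp (I / 8 - g x ^ 2 / 4) ≤ Real.exp (I / 8) * (1 - g x ^ 2 / 8) := by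
    intro x
    have h0 := sq_nonneg (g x)
    rw [sub_eq_add_neg, Real.exp_add]
    gcongr
    rw [Real.exp_neg, inv_le_iff_one_le_mul₀ (Real.exp_pos _)]
    have h1 := Real.add_one_le_exp (g x ^ 2 / 4)
    have h2 : 0 ≤ 1 - g x ^ 2 / 8 := by linarith [hb2 x]
    have h3 := mul_le_mul_of_nonneg_left h1 h2
    nlinarith [hb2 x]
  have hint2 : Integrable (fun x => Real.exp (I / 8) * (1 - g x ^ 2 / 8)) P :=
    ((integrable_const 1).sub (hint.div_const 8)).const_mul _
  calc _ ≤ ∫⁻ x, ENNReal.ofReal (Real.exp (I / 8) * (1 - g x ^ 2 / 8)) ∂P :=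
        lintegral_mono fun x => ENNReal.ofReal_le_ofReal (hpt x)
    _ = ENNReal.ofReal (∫ x, Real.exp (I / 8) * (1 - g x ^ 2 / 8) ∂P) :=
        (ofReal_integral_eq_lintegral_ofReal hint2
          (ae_of_all _ fun x => (Real.exp_pos _).le.trans (hpt x))).symm
    _ ≤ 1 := by
        rw [integral_const_mul, integral_sub (integrable_const 1) (hint.div_const 8),
          integral_div, ← hI, integral_const, ← ENNReal.ofReal_one]
        refine ENNReal.ofReal_le_ofReal ?_
        simp only [probReal_univ, smul_eq_mul, mul_one]
        have h1 := Real.add_one_le_exp (-(I / 8))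
        calc Real.exp (I / 8) * (1 - I / 8) ≤ Real.exp (I / 8) * Real.exp (-(I / 8)) := by
              gcongr; linarith
          _ = 1 := by rw [← Real.exp_add]; simp

variable {X : ℕ → Ω → E}

/-- Over the class, the norm of `L²(P)` is bounded by a multiple of the empirical norm, up to a term
of the order of the entropy at the resolution `n ^ (-2/5)`. -/
lemma exists_measure_norm_le (hG : HasConvexEntropy S G χ A C)
    (hX : ∀ i, Measurable (X i)) (hind : iIndepFun X μ)
    (hid : ∀ i, IdentDistrib (X i) (X 0) μ μ) {P : Measure E} [IsProbabilityMeasure P]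
    (hP : P = μ.map (X 0)) (hχP : ∀ᵐ x ∂P, x ∈ χ) (hχ : ∀ᵐ ω ∂μ, ∀ i, X i ω ∈ χ) :
    ∃ D : ℝ, 0 ≤ D ∧ ∀ n k : ℕ, n ≤ 32 * 32 ^ k →
      μ {ω | ∃ p ∈ S, 8 * ∑ i ∈ Finset.range n, G p (X i ω) ^ 2 + D * 2 ^ k <
        n * ∫ x, G p x ^ 2 ∂P} ≤ ENNReal.ofReal (1 / 2 ^ k) := by
  obtain ⟨T, π, hcard, hπ, hTS, happ⟩ := hG.exists_net
  have hC := hG.nonneg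
  refine ⟨320 * C ^ 2 + 16 * (A + 1), by positivity, fun n k hnk => ?_⟩
  have hint : ∀ p ∈ S, Integrable (fun x => G p x ^ 2) P := fun p hp =>
    (integrable_const (4 : ℝ)).mono' ((hG.measurable p hp).pow_const 2).aestronglyMeasurable
      (ae_of_all _ fun x => by
        rw [Real.norm_eq_abs, abs_of_nonneg (sq_nonneg _)]
        have := sq_le_sq' (abs_le.1 (hG.abs_le p hp x)).1 (abs_le.1 (hG.abs_le p hp x)).2
        linarith)
  have hδ : (n : ℝ) * (C / 4 ^ k) ^ 2 ≤ 32 * 2 ^ k * C ^ 2 := by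
    have h1 : (n : ℝ) / 16 ^ k ≤ 32 * 2 ^ k := by
      rw [div_le_iff₀ (by positivity), mul_assoc, ← mul_pow]
      norm_num
      exact_mod_cast hnk
    have : (n : ℝ) * (C / 4 ^ k) ^ 2 = n / 16 ^ k * C ^ 2 := by
      rw [div_pow, ← pow_mul, mul_comm k 2, pow_mul]; norm_num; ring
    rw [this]; gcongr
  let B : Set Ω := {ω | ∃ p ∈ T k, (A * 2 ^ k : ℕ) + (2 : ℝ) ^ k <
    ∑ i ∈ Finset.range n, ((∫ x, G p x ^ 2 ∂P) / 8 - G p (X i ω) ^ 2 / 4)}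
  have mB : μ B ≤ ENNReal.ofReal (1 / 2 ^ k) := by
    refine (measure_exists_lt_sum_le hX hind hid (T k) (hcard k)
      (V := fun p x => (∫ x, G p x ^ 2 ∂P) / 8 - G p x ^ 2 / 4) ?_ ?_ n _).trans
      (ENNReal.ofReal_le_ofReal (exp_neg_two_pow_le k))
    · intro p hp
      have := hG.measurable p (hTS k p hp)
      fun_prop
    · intro p hp
      have hm := hG.measurable p (hTS k p hp)
      have := lintegral_exp_sub_sq_le_one (P := P) hm (hG.abs_le p (hTS k p hp))
      set I := ∫ x, G p x ^ 2 ∂P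
      rw [hP, lintegral_map (by fun_prop) (hX 0)] at this
      exact this
  have hsub : {ω | ∃ p ∈ S, 8 * ∑ i ∈ Finset.range n, G p (X i ω) ^ 2 +
      (320 * C ^ 2 + 16 * (A + 1)) * 2 ^ k < n * ∫ x, G p x ^ 2 ∂P} ⊆
      {ω | ¬ ∀ i, X i ω ∈ χ} ∪ B := by
    rintro ω ⟨p, hp, hlt⟩
    by_contra hω
    simp only [mem_union, not_or] at hω
    obtain ⟨h1, h2⟩ := hω
    replace h1 : ∀ i, X i ω ∈ χ := not_not.1 h1
    have hπS := hTS k _ (hπ k p hp)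
    have e1 : ∑ i ∈ Finset.range n, ((∫ x, G (π k p) x ^ 2 ∂P) / 8 - G (π k p) (X i ω) ^ 2 / 4)
        ≤ (A * 2 ^ k : ℕ) + (2 : ℝ) ^ k := by
      by_contra hcon
      exact h2 ⟨_, hπ k p hp, not_le.1 hcon⟩
    rw [Finset.sum_sub_distrib, ← Finset.sum_div, ← Finset.sum_div, Finset.sum_const,
      Finset.card_range, nsmul_eq_mul] at e1
    have e2 := sum_sq_le_of_abs_sub_le (n := n) (f := fun i => G (π k p) (X i ω))
      (g := fun i => G p (X i ω)) (δ := C / 4 ^ k)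
      fun i _ => by rw [abs_sub_comm]; exact happ k p hp _ (h1 i)
    have e3 : ∫ x, G p x ^ 2 ∂P ≤ 2 * ∫ x, G (π k p) x ^ 2 ∂P + 2 * (C / 4 ^ k) ^ 2 := by
      calc ∫ x, G p x ^ 2 ∂P ≤ ∫ x, (2 * G (π k p) x ^ 2 + 2 * (C / 4 ^ k) ^ 2) ∂P := by
            refine integral_mono_ae (hint p hp)
              (((hint _ hπS).const_mul 2).add (integrable_const _)) ?_
            filter_upwards [hχP] with x hx
            have h3 := happ k p hp x hx
            have h4 : (G p x - G (π k p) x) ^ 2 ≤ (C / 4 ^ k) ^ 2 :=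
              sq_le_sq' (abs_le.1 h3).1 (abs_le.1 h3).2
            nlinarith [sq_nonneg (G p x - 2 * G (π k p) x)]
        _ = _ := by
            rw [integral_add ((hint _ hπS).const_mul 2) (integrable_const _),
              integral_const_mul, integral_const]
            simp
    have e4 := mul_le_mul_of_nonneg_left e3 (Nat.cast_nonneg (α := ℝ) n)
    push_cast at e1
    linarith
  have hnull : μ {ω | ¬ ∀ i, X i ω ∈ χ} = 0 := hχ
  calc _ ≤ _ := measure_mono hsub
    _ ≤ _ := measure_union_le _ _
    _ ≤ _ := by rw [hnull, zero_add]; exact mB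

end NormComparison

/-! ### The single index class -/

section SingleIndex

variable {d : ℕ} {a b : ℝ} {χ : Set (EuclideanSpace ℝ (Fin d))}

/-- The unit sphere is coded by the integer parts of the coordinates of `N² θ`. This takes only
polynomially many labels; the exponential bound is the form needed for products of codes. -/
lemma codable_sphere [NeZero d] (N : ℕ) (hN : 1 ≤ N) :
    Codable {θ : EuclideanSpace ℝ (Fin d) | ‖θ‖ = 1}
      (fun θ η => ‖θ - η‖ ≤ d / (N : ℝ) ^ 2) (2 ^ (4 * d * N)) := by
  classical
  have hN0 : (0 : ℝ) < N := by exact_mod_cast hN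
  let T : Finset (Fin d → ℤ) := Fintype.piFinset fun _ => Finset.Icc (-(N ^ 2 : ℕ) : ℤ) (N ^ 2 : ℕ)
  have main : Codable {θ : EuclideanSpace ℝ (Fin d) | ‖θ‖ = 1}
      (fun θ η => ‖θ - η‖ ≤ d / (N : ℝ) ^ 2) T.card := by
    refine Codable.of_finset T (fun θ j => ⌊(N : ℝ) ^ 2 * θ j⌋) ?_ ?_
    · intro θ hθ
      rw [Fintype.mem_piFinset]
      intro j
      have h1 : |θ j| ≤ 1 := by
        have := PiLp.norm_apply_le θ j
        rw [show ‖θ‖ = 1 from hθ] at this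
        exact this
      have h2 : |(N : ℝ) ^ 2 * θ j| ≤ N ^ 2 := by
        rw [abs_mul, abs_of_pos (by positivity : (0 : ℝ) < (N : ℝ) ^ 2)]
        exact mul_le_of_le_one_right (by positivity) h1
      rw [abs_le] at h2
      rw [Finset.mem_Icc]
      constructor
      · rw [Int.le_floor]; push_cast; exact h2.1
      · have : (⌊(N : ℝ) ^ 2 * θ j⌋ : ℝ) ≤ ((N ^ 2 : ℕ) : ℤ) :=
          (Int.floor_le _).trans (by push_cast; exact h2.2)
        exact_mod_cast this
    · intro θ _ η _ h
      have h1 : ∀ j, |(θ - η) j| ≤ 1 / (N : ℝ) ^ 2 := by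
        intro j
        have := (Int.abs_sub_lt_one_of_floor_eq_floor (congrFun h j)).le
        rw [← mul_sub, abs_mul, abs_of_pos (by positivity : (0 : ℝ) < (N : ℝ) ^ 2)] at this
        rw [le_div_iff₀ (by positivity), mul_comm]
        exact this
      have hd : (1 : ℝ) ≤ d := by exact_mod_cast NeZero.one_le
      refine abs_le_of_sq_le_sq' ?_ (by positivity) |>.2
      rw [EuclideanSpace.norm_sq_eq]
      calc ∑ j, ‖(θ - η) j‖ ^ 2 ≤ ∑ _j : Fin d, (1 / (N : ℝ) ^ 2) ^ 2 := by
            refine Finset.sum_le_sum fun j _ => ?_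
            rw [Real.norm_eq_abs]
            exact pow_le_pow_left₀ (abs_nonneg _) (h1 j) 2
        _ = d * (1 / (N : ℝ) ^ 2) ^ 2 := by simp
        _ ≤ d ^ 2 * (1 / (N : ℝ) ^ 2) ^ 2 := by gcongr; nlinarith
        _ = _ := by rw [div_pow, div_pow]; ring
  refine main.mono ?_ fun _ _ _ _ h => h
  simp only [T, Fintype.card_piFinset, Int.card_Icc, Finset.prod_const, Finset.card_univ,
    Fintype.card_fin]
  have e : ((N ^ 2 : ℕ) + 1 - -((N ^ 2 : ℕ) : ℤ)).toNat = 2 * N ^ 2 + 1 := by omega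
  rw [e]
  have h1 : 2 * N ^ 2 + 1 ≤ 2 ^ (4 * N) := by
    calc 2 * N ^ 2 + 1 ≤ 2 ^ 2 * N ^ 2 := by nlinarith [Nat.one_le_pow 2 N hN]
      _ ≤ 2 ^ (2 * N) * 2 ^ (2 * N) :=
        Nat.mul_le_mul (Nat.pow_le_pow_right (by norm_num) (by omega)) (sq_le_two_pow N)
      _ = _ := by rw [← pow_add]; congr 1; ring
  calc _ ≤ (2 ^ (4 * N)) ^ d := Nat.pow_le_pow_left h1 d
    _ = _ := by rw [← pow_mul]; congr 1; ring

/-- The function `x ↦ φ(θᵀx)`, where the index is moved to the nearest point of `[a, b]`, so that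
only the values of `φ` there enter. -/
noncomputable def indexFun (a b : ℝ) (p : (ℝ → ℝ) × EuclideanSpace ℝ (Fin d))
    (x : EuclideanSpace ℝ (Fin d)) : ℝ :=
  p.1 (max a (min b (inner ℝ p.2 x)))

lemma clamp_mem (hab : a ≤ b) (t : ℝ) : max a (min b t) ∈ Icc a b :=
  ⟨le_max_left _ _, max_le hab (min_le_left _ _)⟩

lemma clamp_eq {t : ℝ} (ht : t ∈ Icc a b) : max a (min b t) = t := by
  rw [min_eq_right ht.2, max_eq_right ht.1]

lemma continuous_indexFun (hab : a ≤ b) {φ : ℝ → ℝ} (hφ : ContinuousOn φ (Icc a b))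
    (θ : EuclideanSpace ℝ (Fin d)) : Continuous (indexFun a b (φ, θ)) :=
  hφ.comp_continuous (by fun_prop) fun _ => clamp_mem hab _

/-- Pairs of single index functions with link functions in the unit class. -/
def indexPairs (d : ℕ) [NeZero d] (a b : ℝ) :
    Set (((ℝ → ℝ) × EuclideanSpace ℝ (Fin d)) × ((ℝ → ℝ) × EuclideanSpace ℝ (Fin d))) :=
  (unitClass a b ×ˢ Theta d) ×ˢ (unitClass a b ×ˢ Theta d)

/-- The differences of two single index functions with link functions in the unit class have the
entropy of convex functions of one variable: the index vector has a finite-dimensional, hence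
negligible, entropy. -/
lemma exists_hasConvexEntropy [NeZero d] (hab : a < b)
    (hχ : ∀ θ ∈ Theta d, ∀ x ∈ χ, inner ℝ θ x ∈ Icc a b) {T : ℝ} (hT : ∀ x ∈ χ, ‖x‖ ≤ T) :
    ∃ (A : ℕ) (C : ℝ), HasConvexEntropy (indexPairs d a b)
      (fun p x => indexFun a b p.1 x - indexFun a b p.2 x) χ A C := by
  obtain ⟨A, C, hA⟩ := codable_unitClass hab
  have h1 : ∀ N : ℕ, 1 ≤ N → Codable (unitClass a b ×ˢ Theta d)
      (fun p q => ∀ x ∈ χ, |indexFun a b p x - indexFun a b q x| ≤ (|C| + d * |T|) / (N : ℝ) ^ 2)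
      (2 ^ ((A + 4 * d) * N)) := by
    intro N hN
    have c1 := (hA N hN).comap (S := unitClass a b ×ˢ Theta d) Prod.fst (fun p hp => hp.1)
    have c2 := (codable_sphere (d := d) N hN).comap (S := unitClass a b ×ˢ Theta d) Prod.snd
      (fun p hp => hp.2.1)
    refine (c1.inf c2).mono (by rw [← pow_add, ← add_mul]) ?_
    rintro ⟨φ, θ⟩ hp ⟨ψ, η⟩ hq ⟨g1, g2⟩ x hx
    have m1 := hχ θ hp.2 x hx
    have m2 := hχ η hq.2 x hx
    simp only [indexFun]
    rw [clamp_eq m1, clamp_eq m2]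
    have e1 := unitClass.abs_sub_le hp.1 m1 m2
    have e2 := g1 _ m2
    have e3 : |(inner ℝ θ x : ℝ) - inner ℝ η x| ≤ d / (N : ℝ) ^ 2 * |T| := by
      rw [← inner_sub_left]
      exact (abs_real_inner_le_norm _ _).trans
        (mul_le_mul g2 ((hT x hx).trans (le_abs_self T)) (norm_nonneg _) (by positivity))
    have e4 : C / (N : ℝ) ^ 2 ≤ |C| / (N : ℝ) ^ 2 := by gcongr; exact le_abs_self C
    calc |φ (inner ℝ θ x) - ψ (inner ℝ η x)| ≤
          |φ (inner ℝ θ x) - φ (inner ℝ η x)| + |φ (inner ℝ η x) - ψ (inner ℝ η x)| :=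
          abs_sub_le _ _ _
      _ ≤ d / (N : ℝ) ^ 2 * |T| + |C| / (N : ℝ) ^ 2 := add_le_add (e1.trans e3) (e2.trans e4)
      _ = _ := by ring
  refine ⟨(A + 4 * d) + (A + 4 * d), 2 * (|C| + d * |T|), by positivity, ?_, ?_, ?_⟩
  · rintro ⟨⟨φ, θ⟩, ⟨ψ, η⟩⟩ ⟨hp, hq⟩
    exact ((continuous_indexFun hab.le (unitClass.continuousOn hp.1) θ).sub
      (continuous_indexFun hab.le (unitClass.continuousOn hq.1) η)).measurable
  · rintro ⟨⟨φ, θ⟩, ⟨ψ, η⟩⟩ ⟨hp, hq⟩ x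
    have e1 := (hp.1 _ (clamp_mem hab.le (inner ℝ θ x))).1
    have e2 := (hq.1 _ (clamp_mem hab.le (inner ℝ η x))).1
    refine (abs_sub _ _).trans ?_
    simp only [indexFun]
    linarith
  · intro N hN
    have c1 := (h1 N hN).comap (S := indexPairs d a b) Prod.fst (fun p hp => hp.1)
    have c2 := (h1 N hN).comap (S := indexPairs d a b) Prod.snd (fun p hp => hp.2)
    refine (c1.inf c2).mono (by rw [← pow_add, add_mul (A + 4 * d)]) ?_
    rintro p hp q hq ⟨g1, g2⟩ x hx
    have e1 := abs_le.1 (g1 x hx)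
    have e2 := abs_le.1 (g2 x hx)
    have e3 : 2 * (|C| + d * |T|) / (N : ℝ) ^ 2 =
      (|C| + d * |T|) / (N : ℝ) ^ 2 + (|C| + d * |T|) / (N : ℝ) ^ 2 := by ring
    rw [abs_le, e3]
    constructor <;> linarith [e1.1, e1.2, e2.1, e2.2]

end SingleIndex

end ConvexSIM

/-! ### Convex functions with a square integrable second derivative -/

namespace ConvexSIM

section Roughness

variable {a b : ℝ} {m : ℝ → ℝ}

lemma classR.add_mul_sub_le (hm : m ∈ classR (Icc a b)) {t u : ℝ} (ht : t ∈ Icc a b)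
    (hu : u ∈ Icc a b) : m t + derivWithin m (Icc a b) t * (u - t) ≤ m u := by
  have hd := hm.2.1 t ht
  rcases lt_trichotomy t u with h | rfl | h
  · have := hm.1.derivWithin_le_slope ht hu h hd
    rw [slope_def_field, le_div_iff₀ (by linarith)] at this
    linarith
  · simp
  · have := hm.1.slope_le_derivWithin hu ht h hd
    rw [slope_def_field, div_le_iff₀ (by linarith)] at this
    have e : derivWithin m (Icc a b) t * (t - u) = -(derivWithin m (Icc a b) t * (u - t)) := by
      ring
    linarith

/-- Rescaling a function of the class `𝓡` into the unit class. -/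
lemma classR.div_mem_unitClass (hm : m ∈ classR (Icc a b)) {S : ℝ} (hS : 0 < S)
    (h0 : ∀ t ∈ Icc a b, |m t| ≤ S) (h1 : ∀ t ∈ Icc a b, |derivWithin m (Icc a b) t| ≤ S) :
    (fun t => m t / S) ∈ unitClass a b := by
  intro t ht
  refine ⟨?_, derivWithin m (Icc a b) t / S, ?_, fun u hu => ?_⟩
  · rw [abs_div, abs_of_pos hS, div_le_one hS]; exact h0 t ht
  · rw [abs_div, abs_of_pos hS, div_le_one hS]; exact h1 t ht
  · have := classR.add_mul_sub_le hm ht hu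
    dsimp only
    rw [div_mul_eq_mul_div, ← add_div]
    gcongr

lemma lintegral_deriv_sq_eq_roughnessSq :
    ∫⁻ t in Icc a b, ‖deriv (derivWithin m (Icc a b)) t‖ₑ ^ 2 = roughnessSq (Icc a b) m := by
  rw [roughnessSq, ← restrict_Ioo_eq_restrict_Icc]
  refine setLIntegral_congr_fun measurableSet_Ioo fun t ht => ?_
  rw [derivWithin_of_mem_nhds (f := derivWithin m (Icc a b)) (Icc_mem_nhds ht.1 ht.2)]

/-- The derivative of a function with roughness `J` oscillates at most by `√(b - a) J`. -/
lemma classR.abs_derivWithin_sub_le (hm : m ∈ classR (Icc a b))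
    (hJ : roughnessSq (Icc a b) m ≠ ∞) {s t : ℝ} (hs : s ∈ Icc a b) (ht : t ∈ Icc a b) :
    |derivWithin m (Icc a b) t - derivWithin m (Icc a b) s| ≤
      √(b - a) * √(roughnessSq (Icc a b) m).toReal := by
  wlog hst : s ≤ t generalizing s t
  · rw [abs_sub_comm]; exact this ht hs (le_of_not_ge hst)
  have hba : 0 ≤ b - a := by linarith [hs.1, hs.2]
  set g := derivWithin m (Icc a b) with hg
  have hac := hm.2.2 s hs t ht
  rw [← hac.integral_deriv_eq_sub, intervalIntegral.integral_of_le hst]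
  have hsub : Ioc s t ⊆ Icc a b := fun x hx => ⟨hs.1.trans hx.1.le, hx.2.trans ht.2⟩
  have hmeas : Measurable fun x => ‖deriv g x‖ₑ := (measurable_deriv g).enorm
  have h1 : ‖∫ x in Ioc s t, deriv g x‖ₑ ≤
      (roughnessSq (Icc a b) m) ^ (1 / 2 : ℝ) * ENNReal.ofReal (b - a) ^ (1 / 2 : ℝ) := by
    calc ‖∫ x in Ioc s t, deriv g x‖ₑ ≤ ∫⁻ x in Ioc s t, ‖deriv g x‖ₑ :=
          enorm_integral_le_lintegral_enorm _
      _ ≤ ∫⁻ x in Icc a b, ‖deriv g x‖ₑ := lintegral_mono_set hsub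
      _ = ∫⁻ x in Icc a b, ((fun x => ‖deriv g x‖ₑ) * (fun _ => 1 : ℝ → ℝ≥0∞)) x := by simp
      _ ≤ (∫⁻ x in Icc a b, ‖deriv g x‖ₑ ^ (2 : ℝ)) ^ (1 / 2 : ℝ) *
          (∫⁻ x in Icc a b, (1 : ℝ≥0∞) ^ (2 : ℝ)) ^ (1 / 2 : ℝ) :=
          ENNReal.lintegral_mul_le_Lp_mul_Lq (p := 2) (q := 2) _
            (by constructor <;> norm_num) hmeas.aemeasurable aemeasurable_const
      _ = _ := by
          have e : ∀ x, ‖deriv g x‖ₑ ^ (2 : ℝ) = ‖deriv g x‖ₑ ^ 2 := fun x => by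
            rw [← ENNReal.rpow_natCast]; norm_num
          simp only [e, ENNReal.one_rpow, lintegral_const,
            Measure.restrict_apply MeasurableSet.univ, univ_inter, Real.volume_Icc, one_mul]
          rw [hg, lintegral_deriv_sq_eq_roughnessSq]
  rw [← ENNReal.mul_rpow_of_nonneg _ _ (by norm_num)] at h1
  have hfin : (roughnessSq (Icc a b) m * ENNReal.ofReal (b - a)) ^ (1 / 2 : ℝ) ≠ ∞ :=
    ENNReal.rpow_ne_top_of_nonneg (by norm_num) (ENNReal.mul_ne_top hJ ENNReal.ofReal_ne_top)
  have h2 := ENNReal.toReal_mono hfin h1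
  rw [toReal_enorm, Real.norm_eq_abs, ← ENNReal.toReal_rpow, ENNReal.toReal_mul,
    ENNReal.toReal_ofReal hba, ← Real.sqrt_eq_rpow, Real.sqrt_mul ENNReal.toReal_nonneg,
    mul_comm] at h2
  exact h2

lemma classR.continuousOn (hm : m ∈ classR (Icc a b)) : ContinuousOn m (Icc a b) :=
  hm.2.1.continuousOn

end Roughness

section Size

variable {d : ℕ} {P : Measure (EuclideanSpace ℝ (Fin d))} [IsProbabilityMeasure P]

lemma memLp_two_of_ae_norm_le {T : ℝ} (hT : ∀ᵐ x ∂P, ‖x‖ ≤ T)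
    {f : EuclideanSpace ℝ (Fin d) → ℝ} (hf : Measurable f) {B : ℝ}
    (hB : ∀ x, ‖x‖ ≤ T → |f x| ≤ B) : MemLp f 2 P :=
  MemLp.of_bound hf.aestronglyMeasurable B (by filter_upwards [hT] with x hx using hB x hx)

/-- The positive definite covariance matrix bounds the slope of an affine function of the index by
its norm in `L²(P)`, uniformly over the unit sphere. -/
lemma AssumptionA4.exists_mul_sq_le [NeZero d] (h4 : AssumptionA4 P) {T : ℝ}
    (hT : ∀ᵐ x ∂P, ‖x‖ ≤ T) :
    ∃ c : ℝ, 0 < c ∧ ∀ θ : EuclideanSpace ℝ (Fin d), ‖θ‖ = 1 → ∀ α β : ℝ,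
      c * β ^ 2 ≤ ∫ x, (α + β * inner ℝ θ x) ^ 2 ∂P := by
  set M : Matrix (Fin d) (Fin d) ℝ := Matrix.of fun i j : Fin d =>
    cov[fun x : EuclideanSpace ℝ (Fin d) => x i, fun x => x j; P] with hM
  set v : EuclideanSpace ℝ (Fin d) → ℝ := fun θ => ∑ i, ∑ j, θ i * (θ j * M i j) with hv
  have hvc : Continuous v := by fun_prop
  have hvpos : ∀ θ : EuclideanSpace ℝ (Fin d), θ ≠ 0 → 0 < v θ := by
    intro θ hθ
    have h0 : WithLp.ofLp θ ≠ 0 := fun h => hθ (by ext i; exact congrFun h i)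
    have := ((Matrix.posDef_iff_dotProduct_mulVec (M := M)).1 h4).2 h0
    simp only [dotProduct, Matrix.mulVec, Pi.star_apply, star_trivial, Finset.mul_sum] at this
    simpa only [hv, mul_comm (M _ _)] using this
  have hcomp : IsCompact (Metric.sphere (0 : EuclideanSpace ℝ (Fin d)) 1) := isCompact_sphere _ _
  have hne : (Metric.sphere (0 : EuclideanSpace ℝ (Fin d)) 1).Nonempty :=
    ⟨EuclideanSpace.single 0 1, by simp⟩
  obtain ⟨θ₁, hθ₁, hmin⟩ := hcomp.exists_isMinOn hne hvc.continuousOn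
  have hθ₁0 : θ₁ ≠ 0 := by
    rintro rfl; simp at hθ₁
  refine ⟨v θ₁, hvpos θ₁ hθ₁0, fun θ hθ α β => ?_⟩
  have hcoord : ∀ i, MemLp (fun x : EuclideanSpace ℝ (Fin d) => x i) 2 P := fun i =>
    memLp_two_of_ae_norm_le hT (by fun_prop) (B := T) fun x hx =>
      (PiLp.norm_apply_le x i).trans hx
  have hvar : Var[fun x : EuclideanSpace ℝ (Fin d) => (inner ℝ θ x : ℝ); P] = v θ := by
    have e : (fun x : EuclideanSpace ℝ (Fin d) => (inner ℝ θ x : ℝ)) =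
        fun x => ∑ i, θ i * x i := by
      funext x
      simp only [PiLp.inner_apply, RCLike.inner_apply, conj_trivial]
      exact Finset.sum_congr rfl fun i _ => mul_comm _ _
    rw [e, variance_fun_sum fun i => (hcoord i).const_mul (θ i)]
    simp only [covariance_const_mul_left, covariance_const_mul_right, hv, hM, Matrix.of_apply]
    exact Finset.sum_congr rfl fun i _ => Finset.sum_congr rfl fun j _ => by ring
  have hmeas : Measurable fun x : EuclideanSpace ℝ (Fin d) => (inner ℝ θ x : ℝ) := by fun_prop
  calc v θ₁ * β ^ 2 ≤ v θ * β ^ 2 := by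
        gcongr
        exact hmin (by simpa using hθ)
    _ = Var[fun x : EuclideanSpace ℝ (Fin d) => α + β * inner ℝ θ x; P] := by
        rw [variance_const_add (hmeas.const_mul β).aestronglyMeasurable, variance_const_mul, hvar]
        ring
    _ ≤ _ := variance_le_expectation_sq ((hmeas.const_mul β).const_add α).aestronglyMeasurable

variable {a b : ℝ} {m : ℝ → ℝ}

/-- The size of a function of the class `𝓡` and of its derivative is bounded by its roughness and
the norm of the single index function in `L²(P)`: the function differs from its tangent at `a` by a
multiple of the roughness, and the slope of the tangent is controlled by the covariance matrix. -/
lemma exists_abs_le_roughness_add_norm [NeZero d] (hab : a < b) (h4 : AssumptionA4 P) {T : ℝ}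
    (hT : ∀ᵐ x ∂P, ‖x‖ ≤ T) (hD : ∀ θ ∈ Theta d, ∀ᵐ x ∂P, (inner ℝ θ x : ℝ) ∈ Icc a b) :
    ∃ C : ℝ, 0 < C ∧ ∀ m ∈ classR (Icc a b), roughnessSq (Icc a b) m ≠ ∞ → ∀ θ ∈ Theta d,
      ∀ t ∈ Icc a b,
        |m t| ≤ C * (√(roughnessSq (Icc a b) m).toReal + √(∫ x, indexFun a b (m, θ) x ^ 2 ∂P)) ∧
        |derivWithin m (Icc a b) t| ≤
          C * (√(roughnessSq (Icc a b) m).toReal + √(∫ x, indexFun a b (m, θ) x ^ 2 ∂P)) := by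
  obtain ⟨c, hc, hcb⟩ := h4.exists_mul_sq_le hT
  set ℓ := b - a with hℓ
  have hℓ0 : 0 < ℓ := sub_pos.2 hab
  set r := √(2 / c) with hr
  have hr0 : 0 ≤ r := Real.sqrt_nonneg _
  set C₁ := r * (1 + ℓ * √ℓ) + √ℓ with hC₁
  have hC₁0 : 0 ≤ C₁ := by positivity
  refine ⟨1 + ℓ * C₁ + C₁, by positivity, fun m hm hJ θ hθ => ?_⟩
  set J := √(roughnessSq (Icc a b) m).toReal with hJdef
  have hJ0 : 0 ≤ J := Real.sqrt_nonneg _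
  set f : EuclideanSpace ℝ (Fin d) → ℝ := indexFun a b (m, θ) with hf
  set F := √(∫ x, f x ^ 2 ∂P) with hF
  have hF0 : 0 ≤ F := Real.sqrt_nonneg _
  have hcont : Continuous f := continuous_indexFun hab.le (classR.continuousOn hm) θ
  have ha : a ∈ Icc a b := left_mem_Icc.2 hab.le
  set g := derivWithin m (Icc a b) with hg
  have hosc : ∀ t ∈ Icc a b, |g t - g a| ≤ √ℓ * J := fun t ht =>
    classR.abs_derivWithin_sub_le hm hJ ha ht
  obtain ⟨Bm, hBm⟩ := isCompact_Icc.exists_bound_of_continuousOn (classR.continuousOn hm)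
  have hintf : Integrable (fun x => f x ^ 2) P :=
    (integrable_const (Bm ^ 2)).mono' (by fun_prop) (ae_of_all _ fun x => by
      rw [norm_pow]
      exact pow_le_pow_left₀ (norm_nonneg _) (hBm _ (clamp_mem hab.le _)) 2)
  have hF2 : F ^ 2 = ∫ x, f x ^ 2 ∂P := Real.sq_sqrt (integral_nonneg fun x => sq_nonneg _)
  -- the remainder of the tangent at `a`
  have hrem : ∀ t ∈ Icc a b, |m t - (m a + g a * (t - a))| ≤ ℓ * √ℓ * J := by
    intro t ht
    have h1 := Convex.norm_image_sub_le_of_norm_hasDerivWithin_le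
      (f := fun t => m t - g a * t) (f' := fun t => g t - g a * 1) (s := Icc a b) (C := √ℓ * J)
      (fun x hx => (hm.2.1 x hx).hasDerivWithinAt.sub ((hasDerivWithinAt_id x _).const_mul (g a)))
      (fun x hx => by simpa using hosc x hx) (convex_Icc a b) ha ht
    simp only [Real.norm_eq_abs] at h1
    have e : m t - (m a + g a * (t - a)) = m t - g a * t - (m a - g a * a) := by ring
    rw [e]
    refine h1.trans ?_
    have h2 : |t - a| ≤ ℓ := by
      rw [abs_of_nonneg (by linarith [ht.1])]; linarith [ht.2]
    calc √ℓ * J * |t - a| ≤ √ℓ * J * ℓ := by gcongr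
      _ = _ := by ring
  have hslope : |g a| ≤ r * (F + ℓ * √ℓ * J) := by
    have h1 := hcb θ hθ.1 (m a - g a * a) (g a)
    have h2 : ∫ x, (m a - g a * a + g a * inner ℝ θ x) ^ 2 ∂P ≤
        2 * F ^ 2 + 2 * (ℓ * √ℓ * J) ^ 2 := by
      calc _ ≤ ∫ x, (2 * f x ^ 2 + 2 * (ℓ * √ℓ * J) ^ 2) ∂P := by
            refine integral_mono_of_nonneg (ae_of_all _ fun x => sq_nonneg _)
              ((hintf.const_mul 2).add (integrable_const _)) ?_
            filter_upwards [hD θ hθ] with x hx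
            have h3 := abs_le.1 (hrem _ hx)
            have h4 : f x = m (inner ℝ θ x) := by
              rw [hf]; simp only [indexFun]; rw [clamp_eq hx]
            rw [h4]
            have h5 : (m (inner ℝ θ x) - (m a + g a * (inner ℝ θ x - a))) ^ 2 ≤
                (ℓ * √ℓ * J) ^ 2 := sq_le_sq' h3.1 h3.2
            have e : m a - g a * a + g a * inner ℝ θ x =
              m a + g a * (inner ℝ θ x - a) := by ring
            rw [e]
            set y := m a + g a * (inner ℝ θ x - a)
            nlinarith [sq_nonneg (2 * m (inner ℝ θ x) - y)]
        _ = _ := by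
            rw [integral_add (hintf.const_mul 2) (integrable_const _), integral_const_mul,
              integral_const, hF2]
            simp
    have h3 : |g a| ^ 2 ≤ (r * (F + ℓ * √ℓ * J)) ^ 2 := by
      rw [sq_abs, mul_pow, hr, Real.sq_sqrt (by positivity), div_mul_eq_mul_div,
        le_div_iff₀ hc]
      have : 0 ≤ F * (ℓ * √ℓ * J) := by positivity
      nlinarith
    exact le_of_sq_le_sq h3 (by positivity)
  have hg1 : ∀ t ∈ Icc a b, |g t| ≤ C₁ * (J + F) := by
    intro t ht
    have h1 : |g t| ≤ |g t - g a| + |g a| := by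
      have := abs_add_le (g t - g a) (g a); rwa [sub_add_cancel] at this
    have h2 := hosc t ht
    have h3 : r * (F + ℓ * √ℓ * J) + √ℓ * J ≤ C₁ * (J + F) := by
      have : 0 ≤ r * J + r * (ℓ * √ℓ) * F + √ℓ * F := by positivity
      rw [hC₁]
      linarith
    linarith
  intro t ht
  have hJF : 0 ≤ J + F := by positivity
  constructor
  -- at some point of `D` the function is at most its norm, and from there the slopes bound it
  · obtain ⟨x, hx, hxF⟩ := exists_notMem_null_le_integral hintf (hD θ hθ)
    replace hx : (inner ℝ θ x : ℝ) ∈ Icc a b := not_not.1 hx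
    rw [← hF2] at hxF
    have h1 : |f x| ≤ F := abs_le_of_sq_le_sq hxF hF0
    have h2 : f x = m (inner ℝ θ x) := by
      rw [hf]; simp only [indexFun]; rw [clamp_eq hx]
    have h3 := Convex.norm_image_sub_le_of_norm_derivWithin_le hm.2.1
      (fun y hy => hg1 y hy) (convex_Icc a b) hx ht
    rw [Real.norm_eq_abs, Real.norm_eq_abs, ← h2] at h3
    have h4 : |t - inner ℝ θ x| ≤ ℓ := by
      rw [abs_le]; constructor <;> linarith [ht.1, ht.2, hx.1, hx.2]
    have h5 : C₁ * (J + F) * |t - inner ℝ θ x| ≤ C₁ * (J + F) * ℓ := by gcongr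
    have h6 : |m t| ≤ |m t - f x| + |f x| := by
      have := abs_add_le (m t - f x) (f x); rwa [sub_add_cancel] at this
    have h7 : 0 ≤ C₁ * (J + F) := by positivity
    linarith
  · have h1 := hg1 t ht
    have h2 : 0 ≤ ℓ * C₁ * (J + F) := by positivity
    linarith

end Size

end ConvexSIM

/-! ### The basic inequality -/

namespace ConvexSIM

/-- The algebra which turns the basic inequality into rates. Here `Q` and `p` are the squared
empirical and `L²(P)` errors, `J` is the roughness of the estimator, `F` its norm, `S` the scale by
which it is brought into the unit class, `N` the multiplier process at the error, `ρ` the rate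
`n ^ (-4/5)` and `l` the squared smoothing parameter. -/
lemma exists_bound_of_basic_inequality {C₁ D₁ D₂ M J₀ F₀ : ℝ} (hC₁ : 0 < C₁) (hD₂ : 0 ≤ D₂)
    (hM : 1 ≤ M) : ∃ B δ : ℝ, 0 < B ∧ 0 < δ ∧ ∀ Q p J F N ρ l S : ℝ, 0 ≤ Q → 0 ≤ ρ → ρ ≤ δ →
      ρ ≤ M * l → 0 < l → l ≤ 1 → S = 1 + C₁ * (J + F) + C₁ * (J₀ + F₀) → 1 ≤ S →
      p ≤ 8 * Q + D₂ * ρ * S ^ 2 → N ≤ Q / 8 + D₁ * ρ * S →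
      Q + l * J ^ 2 ≤ 2 * N + l * J₀ ^ 2 → F ^ 2 ≤ 2 * p + 2 * F₀ ^ 2 →
      J ^ 2 ≤ B ∧ S ^ 2 ≤ B ∧ p ≤ B * l := by
  set A₁ := 3 * (1 + C₁ * (J₀ + F₀)) ^ 2 + 6 * C₁ ^ 2 * F₀ ^ 2 with hA₁
  set K := 384 * C₁ ^ 2 * M with hK
  set R := M * (2 * A₁ / K + D₁ ^ 2 * K) + J₀ ^ 2 with hR
  set B₁ := 2 * A₁ + 204 * C₁ ^ 2 * R with hB₁
  have hA₁0 : 0 ≤ A₁ := by positivity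
  have hK0 : 0 < K := by positivity
  have hR0 : 0 ≤ R := by positivity
  have hB₁0 : 0 ≤ B₁ := by positivity
  refine ⟨1 + 2 * R + B₁ + (16 * R + D₂ * M * B₁), min 1 (1 / (12 * C₁ ^ 2 * (D₂ + 1))),
    by positivity, by positivity, ?_⟩
  intro Q p J F N ρ l S hQ hρ hρδ hρM hl hl1 hS hS1 hp hN hbasic hF
  have hρ1 : ρ ≤ 1 := hρδ.trans (min_le_left _ _)
  have hρ2 : 6 * C₁ ^ 2 * (D₂ * ρ) ≤ 1 / 2 := by
    have h1 := hρδ.trans (min_le_right _ _)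
    rw [le_div_iff₀ (by positivity)] at h1
    have : 0 ≤ C₁ ^ 2 * ρ := by positivity
    linarith
  -- as `ρ` is small, the part of `F²` which comes from the norm comparison is absorbed by `S²`
  have hS2 : S ^ 2 ≤ 2 * A₁ + 6 * C₁ ^ 2 * J ^ 2 + 96 * C₁ ^ 2 * Q := by
    have h1 : S ^ 2 ≤ 3 * (1 + C₁ * (J₀ + F₀)) ^ 2 + 3 * (C₁ * J) ^ 2 + 3 * (C₁ * F) ^ 2 := by
      have e : S = (1 + C₁ * (J₀ + F₀)) + C₁ * J + C₁ * F := by rw [hS]; ring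
      rw [e]
      nlinarith [sq_nonneg (1 + C₁ * (J₀ + F₀) - C₁ * J), sq_nonneg (1 + C₁ * (J₀ + F₀) - C₁ * F),
        sq_nonneg (C₁ * J - C₁ * F)]
    have h2 : 3 * (C₁ * F) ^ 2 ≤ 3 * C₁ ^ 2 * (2 * (8 * Q + D₂ * ρ * S ^ 2) + 2 * F₀ ^ 2) := by
      rw [mul_pow, ← mul_assoc]
      gcongr
      linarith
    have h3 : 6 * C₁ ^ 2 * (D₂ * ρ) * S ^ 2 ≤ 1 / 2 * S ^ 2 := by gcongr
    rw [hA₁]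
    linarith
  -- Young's inequality, with weight `K` so large that `Q` and, as `ρ ≤ M l`, `l J²` are absorbed
  have hmain : Q / 2 + l * J ^ 2 / 2 ≤ l * R := by
    have h1 : 2 * (D₁ * ρ * S) ≤ ρ * (S ^ 2 / K + D₁ ^ 2 * K) := by
      have h2 : 2 * (D₁ * S) ≤ S ^ 2 / K + D₁ ^ 2 * K := by
        have : 0 ≤ (S - D₁ * K) ^ 2 / K := by positivity
        have e : (S - D₁ * K) ^ 2 / K = S ^ 2 / K + D₁ ^ 2 * K - 2 * (D₁ * S) := by
          field_simp; ring
        linarith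
      calc 2 * (D₁ * ρ * S) = ρ * (2 * (D₁ * S)) := by ring
        _ ≤ _ := by gcongr
    have h2 : S ^ 2 / K ≤ 2 * A₁ / K + J ^ 2 / (64 * M) + Q / 4 := by
      have e1 : J ^ 2 / (64 * M) = 6 * C₁ ^ 2 * J ^ 2 / K := by rw [hK]; field_simp; ring
      have e2 : 96 * C₁ ^ 2 * Q / K ≤ Q / 4 := by
        rw [div_le_div_iff₀ hK0 (by norm_num), hK]
        have : C₁ ^ 2 * Q * 1 ≤ C₁ ^ 2 * Q * M := by gcongr
        linarith
      calc S ^ 2 / K ≤ (2 * A₁ + 6 * C₁ ^ 2 * J ^ 2 + 96 * C₁ ^ 2 * Q) / K := by gcongr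
        _ = 2 * A₁ / K + 6 * C₁ ^ 2 * J ^ 2 / K + 96 * C₁ ^ 2 * Q / K := by ring
        _ ≤ _ := by rw [e1]; gcongr
    have h3 : ρ * (J ^ 2 / (64 * M)) ≤ l * J ^ 2 / 2 := by
      calc ρ * (J ^ 2 / (64 * M)) ≤ M * l * (J ^ 2 / (64 * M)) := by gcongr
        _ = l * J ^ 2 / 64 := by field_simp
        _ ≤ _ := by have : 0 ≤ l * J ^ 2 := by positivity
                    linarith
    have h4 : ρ * (Q / 4) ≤ Q / 4 := mul_le_of_le_one_left (by positivity) hρ1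
    have h5 : ρ * (2 * A₁ / K + D₁ ^ 2 * K) ≤ M * l * (2 * A₁ / K + D₁ ^ 2 * K) := by gcongr
    have h6 : ρ * (S ^ 2 / K) ≤ ρ * (2 * A₁ / K + J ^ 2 / (64 * M) + Q / 4) := by gcongr
    rw [hR]
    linarith
  have hQ2 : Q ≤ 2 * R * l := by
    have : 0 ≤ l * J ^ 2 := by positivity
    linarith
  have hJ2 : J ^ 2 ≤ 2 * R := by
    have h1 : l * J ^ 2 ≤ l * (2 * R) := by linarith
    exact le_of_mul_le_mul_left h1 hl
  have hSB : S ^ 2 ≤ B₁ := by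
    have h1 : Q ≤ 2 * R := hQ2.trans (mul_le_of_le_one_right (by positivity) hl1)
    have h2 : 6 * C₁ ^ 2 * J ^ 2 ≤ 6 * C₁ ^ 2 * (2 * R) := by gcongr
    have h3 : 96 * C₁ ^ 2 * Q ≤ 96 * C₁ ^ 2 * (2 * R) := by gcongr
    rw [hB₁]
    linarith
  have h1 : 0 ≤ D₂ * M * B₁ := by positivity
  refine ⟨by linarith, by linarith, ?_⟩
  have h2 : D₂ * ρ * S ^ 2 ≤ D₂ * (M * l) * B₁ := by gcongr
  have h3 : 0 ≤ (1 + 2 * R + B₁) * l := by positivity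
  linarith

variable {d : ℕ} {a b : ℝ}

lemma indexFun_eq {m : ℝ → ℝ} {θ x : EuclideanSpace ℝ (Fin d)}
    (h : (inner ℝ θ x : ℝ) ∈ Icc a b) : indexFun a b (m, θ) x = m (inner ℝ θ x) := by
  simp only [indexFun]; rw [clamp_eq h]

variable [NeZero d]

/-- The minimizing property of the estimator, compared with the true parameters. -/
lemma IsPLSE.basic_inequality {n : ℕ} (hn : 1 ≤ n) {x : ℕ → EuclideanSpace ℝ (Fin d)} {y : ℕ → ℝ}
    {lam : ℝ} (hlam : lam ≠ 0) {m m₀ : ℝ → ℝ} {θ θ₀ : EuclideanSpace ℝ (Fin d)}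
    (h : IsPLSE (Icc a b) n x y lam m θ) (hm₀ : m₀ ∈ classR (Icc a b)) (hθ₀ : θ₀ ∈ Theta d)
    (hJ₀ : roughnessSq (Icc a b) m₀ ≠ ∞)
    (hx : ∀ θ ∈ Theta d, ∀ i, (inner ℝ θ (x i) : ℝ) ∈ Icc a b) :
    roughnessSq (Icc a b) m ≠ ∞ ∧
    (∑ i ∈ Finset.range n, (indexFun a b (m, θ) (x i) - indexFun a b (m₀, θ₀) (x i)) ^ 2) / n +
        lam ^ 2 * (roughnessSq (Icc a b) m).toReal ≤
      2 * ((∑ i ∈ Finset.range n, (y i - indexFun a b (m₀, θ₀) (x i)) *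
        (indexFun a b (m, θ) (x i) - indexFun a b (m₀, θ₀) (x i))) / n) +
        lam ^ 2 * (roughnessSq (Icc a b) m₀).toReal := by
  obtain ⟨hm, hθ, hmin⟩ := h
  have hn0 : (0 : ℝ) < n := by exact_mod_cast hn
  have hl : 0 < lam ^ 2 := by positivity
  have hle := hmin m₀ hm₀ θ₀ hθ₀
  simp only [penalizedLoss] at hle
  have hfin : ENNReal.ofReal (lossQ n x y m₀ θ₀) +
      ENNReal.ofReal (lam ^ 2) * roughnessSq (Icc a b) m₀ ≠ ∞ :=
    ENNReal.add_ne_top.2 ⟨ENNReal.ofReal_ne_top, ENNReal.mul_ne_top ENNReal.ofReal_ne_top hJ₀⟩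
  have hfin1 : ENNReal.ofReal (lam ^ 2) * roughnessSq (Icc a b) m ≠ ∞ := fun h => by
    rw [h, add_top, top_le_iff] at hle
    exact hfin hle
  have hJ : roughnessSq (Icc a b) m ≠ ∞ := fun h => by
    rw [h, ENNReal.mul_top (by simpa using hlam)] at hfin1
    exact hfin1 rfl
  refine ⟨hJ, ?_⟩
  have hQ : ∀ m θ, 0 ≤ lossQ n x y m θ := fun m θ =>
    div_nonneg (Finset.sum_nonneg fun _ _ => sq_nonneg _) hn0.le
  have hre := ENNReal.toReal_mono hfin hle
  rw [ENNReal.toReal_add ENNReal.ofReal_ne_top hfin1,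
    ENNReal.toReal_add ENNReal.ofReal_ne_top (ENNReal.mul_ne_top ENNReal.ofReal_ne_top hJ₀),
    ENNReal.toReal_mul, ENNReal.toReal_mul, ENNReal.toReal_ofReal (hQ _ _),
    ENNReal.toReal_ofReal (hQ _ _), ENNReal.toReal_ofReal hl.le] at hre
  have e : lossQ n x y m θ = lossQ n x y m₀ θ₀ -
      2 * ((∑ i ∈ Finset.range n, (y i - indexFun a b (m₀, θ₀) (x i)) *
        (indexFun a b (m, θ) (x i) - indexFun a b (m₀, θ₀) (x i))) / n) +
      (∑ i ∈ Finset.range n,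
        (indexFun a b (m, θ) (x i) - indexFun a b (m₀, θ₀) (x i)) ^ 2) / n := by
    simp only [lossQ]
    rw [← mul_div_assoc, ← sub_div, ← add_div, Finset.mul_sum, ← Finset.sum_sub_distrib,
      ← Finset.sum_add_distrib]
    congr 1
    refine Finset.sum_congr rfl fun i _ => ?_
    rw [indexFun_eq (hx θ hθ i), indexFun_eq (hx θ₀ hθ₀ i)]
    ring
  linarith

/-! ### The index set and the model -/

lemma isCompact_Theta : IsCompact (Theta d) := by
  have e : Theta d = Metric.sphere 0 1 ∩ {η : EuclideanSpace ℝ (Fin d) | 0 ≤ η 0} := by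
    ext η; simp [Theta]
  rw [e]
  exact (isCompact_sphere _ _).inter_right (isClosed_le continuous_const (by fun_prop))

/-- The index set is a compact interval, and nondegenerate since it contains an open one. -/
lemma exists_indexSet_eq_Icc {P : Measure (EuclideanSpace ℝ (Fin d))}
    {θ₀ : EuclideanSpace ℝ (Fin d)} (hθ₀ : θ₀ ∈ Theta d) (h0 : AssumptionA0 P θ₀)
    (h1 : AssumptionA1 P) (hconv : Convex ℝ (indexSet P)) :
    ∃ a b : ℝ, a < b ∧ indexSet P = Icc a b := by
  have hcomp : IsCompact (indexSet P) := by
    have e : indexSet P = (fun q : EuclideanSpace ℝ (Fin d) × EuclideanSpace ℝ (Fin d) =>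
        (inner ℝ q.1 q.2 : ℝ)) '' (Theta d ×ˢ P.support) := by
      ext t
      simp only [indexSet, mem_ofPred_eq, mem_image, mem_prod, Prod.exists]
      constructor
      · rintro ⟨θ, hθ, x, hx, rfl⟩; exact ⟨θ, x, ⟨hθ, hx⟩, rfl⟩
      · rintro ⟨θ, x, ⟨hθ, hx⟩, rfl⟩; exact ⟨θ, hθ, x, hx, rfl⟩
    rw [e]
    exact (isCompact_Theta.prod h1.1).image (by fun_prop)
  obtain ⟨-, d₁, -, -, -, -, a, b, hab, c, -, hc⟩ := h0
  have hsub : Ioo a b ⊆ indexSet P := fun t ht => by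
    obtain ⟨x, hx, -, rfl⟩ := hc 0 ht
    exact ⟨θ₀, hθ₀, x, hx, rfl⟩
  have hu : (2 * a + b) / 3 ∈ indexSet P := hsub ⟨by linarith, by linarith⟩
  have hv : (a + 2 * b) / 3 ∈ indexSet P := hsub ⟨by linarith, by linarith⟩
  have hI := eq_Icc_of_connected_compact ⟨⟨_, hu⟩, hconv.isPreconnected⟩ hcomp
  refine ⟨_, _, ?_, hI⟩
  rw [hI] at hu hv
  have e1 := hu.1
  have e2 := hv.2
  linarith

/-- The scaling by which an estimator and the true link function are brought into the unit class
turns the two empirical process bounds into bounds for the error itself. -/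
lemma error_bounds_of_scale {P : Measure (EuclideanSpace ℝ (Fin d))} {n k : ℕ} (hn : 1 ≤ n)
    {x : ℕ → EuclideanSpace ℝ (Fin d)} {e : ℕ → ℝ} {m m₀ : ℝ → ℝ}
    {θ θ₀ : EuclideanSpace ℝ (Fin d)} {S D₁ D₂ : ℝ} (hS : 1 ≤ S)
    (hmem : (((fun t => m t / S), θ), ((fun t => m₀ t / S), θ₀)) ∈ indexPairs d a b)
    (h1 : ∀ p ∈ indexPairs d a b, ∑ i ∈ Finset.range n,
        e i * (indexFun a b p.1 (x i) - indexFun a b p.2 (x i)) ≤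
      1 / 8 * ∑ i ∈ Finset.range n, (indexFun a b p.1 (x i) - indexFun a b p.2 (x i)) ^ 2 +
        D₁ * 2 ^ k)
    (h2 : ∀ p ∈ indexPairs d a b,
      n * ∫ x, (indexFun a b p.1 x - indexFun a b p.2 x) ^ 2 ∂P ≤
      8 * ∑ i ∈ Finset.range n, (indexFun a b p.1 (x i) - indexFun a b p.2 (x i)) ^ 2 +
        D₂ * 2 ^ k) :
    (∑ i ∈ Finset.range n, e i * (indexFun a b (m, θ) (x i) - indexFun a b (m₀, θ₀) (x i))) / n ≤
      (∑ i ∈ Finset.range n,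
        (indexFun a b (m, θ) (x i) - indexFun a b (m₀, θ₀) (x i)) ^ 2) / n / 8 +
        D₁ * (2 ^ k / n) * S ∧
    ∫ x, (indexFun a b (m, θ) x - indexFun a b (m₀, θ₀) x) ^ 2 ∂P ≤
      8 * ((∑ i ∈ Finset.range n,
        (indexFun a b (m, θ) (x i) - indexFun a b (m₀, θ₀) (x i)) ^ 2) / n) +
        D₂ * (2 ^ k / n) * S ^ 2 := by
  have hn0 : (0 : ℝ) < n := by exact_mod_cast hn
  have hS0 : 0 < S := by linarith
  set Δ : EuclideanSpace ℝ (Fin d) → ℝ := fun x => indexFun a b (m, θ) x - indexFun a b (m₀, θ₀) x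
    with hΔ
  have hdiv : ∀ x, indexFun a b ((fun t => m t / S), θ) x -
      indexFun a b ((fun t => m₀ t / S), θ₀) x = Δ x / S := fun x => by
    simp only [indexFun, hΔ, sub_div]
  have g1 := h1 _ hmem
  have g2 := h2 _ hmem
  simp only [hdiv, div_pow, ← mul_div_assoc, ← Finset.sum_div, integral_div] at g1 g2
  set V := ∑ i ∈ Finset.range n, Δ (x i) ^ 2 with hV
  have hV0 : 0 ≤ V := Finset.sum_nonneg fun _ _ => sq_nonneg _
  constructor
  · rw [div_le_iff₀ hS0] at g1
    have e1 : (1 / 8 * V / S ^ 2 + D₁ * 2 ^ k) * S = V / 8 / S + D₁ * 2 ^ k * S := by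
      field_simp
    have e2 : V / 8 / S ≤ V / 8 := div_le_self (by positivity) hS
    rw [div_le_iff₀ hn0]
    have e3 : (V / n / 8 + D₁ * (2 ^ k / n) * S) * n = V / 8 + D₁ * 2 ^ k * S := by field_simp
    rw [e3]
    linarith
  · rw [div_le_iff₀ (by positivity)] at g2
    have e1 : (8 * V / S ^ 2 + D₂ * 2 ^ k) * S ^ 2 = 8 * V + D₂ * 2 ^ k * S ^ 2 := by field_simp
    have e3 : 8 * (V / n) + D₂ * (2 ^ k / n) * S ^ 2 = (8 * V + D₂ * 2 ^ k * S ^ 2) / n := by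
      field_simp
    rw [e3, le_div_iff₀ hn0]
    linarith

end ConvexSIM

/-! ### From empirical bounds to rates -/

namespace ConvexSIM

/-- If `λ⁻¹` is at most of order `n ^ (2/5)`, the rate `2ᵏ / n ≤ n ^ (-4/5)` is at most of
order `λ²`. -/
lemma two_pow_div_le_of_inv_le {n k : ℕ} (hn : 1 ≤ n) (hk : 32 ^ k ≤ n) {lam : ℝ} (hlam : lam ≠ 0)
    {M : ℝ≥0} (h : ‖lam‖ₑ⁻¹ ≤ M * (n : ℝ≥0∞) ^ (2 / 5 : ℝ)) :
    (2 : ℝ) ^ k / n ≤ (M : ℝ) ^ 2 * lam ^ 2 := by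
  have hn0 : (0 : ℝ) < n := by exact_mod_cast hn
  set x : ℝ := (n : ℝ) ^ (1 / 5 : ℝ) with hx
  have hx0 : 0 < x := Real.rpow_pos_of_pos hn0 _
  have hx5 : x ^ 5 = n := by
    rw [hx, ← Real.rpow_natCast, ← Real.rpow_mul hn0.le]; norm_num
  have hx2 : (n : ℝ) ^ (2 / 5 : ℝ) = x ^ 2 := by
    rw [hx, ← Real.rpow_natCast, ← Real.rpow_mul hn0.le]; norm_num
  have h1 : |lam|⁻¹ ≤ M * x ^ 2 := by
    have e : (n : ℝ≥0∞) ^ (2 / 5 : ℝ) = ENNReal.ofReal (x ^ 2) := by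
      rw [← hx2, ← ENNReal.ofReal_rpow_of_nonneg hn0.le (by norm_num), ENNReal.ofReal_natCast]
    have h2 := ENNReal.toReal_mono (ENNReal.mul_ne_top ENNReal.coe_ne_top
      (by rw [e]; exact ENNReal.ofReal_ne_top)) h
    rw [e, ENNReal.toReal_inv, toReal_enorm, Real.norm_eq_abs, ENNReal.toReal_mul,
      ENNReal.toReal_ofReal (by positivity), ENNReal.coe_toReal] at h2
    exact h2
  have hl : 0 < |lam| := abs_pos.2 hlam
  have h2 : 1 ≤ M * x ^ 2 * |lam| := by
    have := mul_le_mul_of_nonneg_right h1 hl.le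
    rwa [inv_mul_cancel₀ hl.ne'] at this
  have h3 : 1 ≤ (M : ℝ) ^ 2 * x ^ 4 * lam ^ 2 := by
    have h4 := one_le_pow₀ h2 (n := 2)
    have e : (M * x ^ 2 * |lam|) ^ 2 = (M : ℝ) ^ 2 * x ^ 4 * lam ^ 2 := by
      rw [mul_pow, mul_pow, sq_abs]; ring
    rwa [e] at h4
  have h5 : (2 : ℝ) ^ k ≤ x := by
    refine le_of_pow_le_pow_left₀ (n := 5) (by norm_num) hx0.le ?_
    rw [hx5, ← pow_mul, mul_comm, pow_mul]
    norm_num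
    exact_mod_cast hk
  rw [div_le_iff₀ hn0, ← hx5]
  calc (2 : ℝ) ^ k ≤ x * 1 := by rw [mul_one]; exact h5
    _ ≤ x * ((M : ℝ) ^ 2 * x ^ 4 * lam ^ 2) := by gcongr
    _ = _ := by ring

lemma sq_le_one_of_enorm_le {n : ℕ} (hn : 1 ≤ n) {lam : ℝ}
    (h : ‖lam‖ₑ ≤ (n : ℝ≥0∞) ^ (-(1 / 4) : ℝ)) : lam ^ 2 ≤ 1 := by
  have h1 : (n : ℝ≥0∞) ^ (-(1 / 4) : ℝ) ≤ 1 :=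
    ENNReal.rpow_le_one_of_one_le_of_neg (by exact_mod_cast hn) (by norm_num)
  have h2 := ENNReal.toReal_mono ENNReal.one_ne_top (h.trans h1)
  rw [toReal_enorm, Real.norm_eq_abs, ENNReal.toReal_one] at h2
  rw [← sq_abs]
  exact pow_le_one₀ (abs_nonneg _) h2

lemma tendsto_natLog_atTop : Tendsto (Nat.log 32) atTop atTop :=
  tendsto_atTop.2 fun k => eventually_atTop.2 ⟨32 ^ k, fun _ hn =>
    Nat.le_log_of_pow_le (by norm_num) hn⟩

lemma tendsto_ofReal_div_two_pow (c : ℝ) :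
    Tendsto (fun n : ℕ => ENNReal.ofReal (c / 2 ^ Nat.log 32 n)) atTop (𝓝 0) := by
  have h : Tendsto (fun k : ℕ => c / (2 : ℝ) ^ k) atTop (𝓝 0) :=
    tendsto_const_nhds.div_atTop (tendsto_pow_atTop_atTop_of_one_lt (by norm_num))
  have := (ENNReal.tendsto_ofReal h).comp tendsto_natLog_atTop
  simpa [Function.comp_def] using this

lemma le_sqrt_add_one (B : ℝ) (hB : 0 ≤ B) : √B ≤ B + 1 := by
  rw [Real.sqrt_le_left (by positivity)]
  nlinarith

/-- A bound for a squared norm, as a bound for the extended norm. -/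
lemma eLpNorm_two_le_of_integral_sq_le {E : Type*} [MeasurableSpace E] {P : Measure E} {f : E → ℝ}
    (hf : MemLp f 2 P) {B l : ℝ} (hB : 0 ≤ B) (h : ∫ x, f x ^ 2 ∂P ≤ B * l ^ 2) :
    eLpNorm f 2 P ≤ ENNReal.ofReal (B + 1) * ‖l‖ₑ := by
  rw [hf.eLpNorm_eq_integral_rpow_norm two_ne_zero (by norm_num)]
  have e : ∀ x, ‖f x‖ ^ (2 : ℝ≥0∞).toReal = f x ^ 2 := fun x => by
    rw [ENNReal.toReal_ofNat, Real.rpow_ofNat, Real.norm_eq_abs, sq_abs]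
  simp only [e]
  rw [← ofReal_norm, ← ENNReal.ofReal_mul (by positivity), ENNReal.toReal_ofNat,
    show ((2 : ℝ)⁻¹) = 1 / 2 by norm_num, ← Real.sqrt_eq_rpow]
  refine ENNReal.ofReal_le_ofReal ?_
  calc √(∫ x, f x ^ 2 ∂P) ≤ √(B * l ^ 2) := Real.sqrt_le_sqrt h
    _ = √B * ‖l‖ := by rw [Real.sqrt_mul hB, Real.sqrt_sq_eq_abs, Real.norm_eq_abs]
    _ ≤ _ := by gcongr; exact le_sqrt_add_one B hB

variable {d : ℕ} [NeZero d] {a b : ℝ}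

/-- The deterministic part of the argument: bounds for the empirical processes, and for the
smoothing parameter, yield the bounds for the estimator. -/
lemma exists_bound_of_empirical_bounds (hab : a < b) {P : Measure (EuclideanSpace ℝ (Fin d))}
    [IsProbabilityMeasure P] (h4 : AssumptionA4 P) {T : ℝ} (hT : ∀ᵐ x ∂P, ‖x‖ ≤ T)
    (hD : ∀ θ ∈ Theta d, ∀ᵐ x ∂P, (inner ℝ θ x : ℝ) ∈ Icc a b) {m₀ : ℝ → ℝ}
    {θ₀ : EuclideanSpace ℝ (Fin d)} (hm₀ : m₀ ∈ classR (Icc a b)) (hθ₀ : θ₀ ∈ Theta d)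
    (hJ₀ : roughnessSq (Icc a b) m₀ ≠ ∞) {D₁ D₂ M : ℝ} (hD₂ : 0 ≤ D₂) (hM : 1 ≤ M) :
    ∃ B δ : ℝ, 0 ≤ B ∧ 0 < δ ∧ ∀ (n k : ℕ) (x : ℕ → EuclideanSpace ℝ (Fin d)) (y : ℕ → ℝ)
      (lam : ℝ) (m : ℝ → ℝ) (θ : EuclideanSpace ℝ (Fin d)), 1 ≤ n →
      (∀ θ ∈ Theta d, ∀ i, (inner ℝ θ (x i) : ℝ) ∈ Icc a b) → lam ≠ 0 → lam ^ 2 ≤ 1 →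
      (2 : ℝ) ^ k / n ≤ M * lam ^ 2 → (2 : ℝ) ^ k / n ≤ δ → IsPLSE (Icc a b) n x y lam m θ →
      (∀ p ∈ indexPairs d a b, ∑ i ∈ Finset.range n,
          (y i - indexFun a b (m₀, θ₀) (x i)) *
            (indexFun a b p.1 (x i) - indexFun a b p.2 (x i)) ≤
        1 / 8 * ∑ i ∈ Finset.range n, (indexFun a b p.1 (x i) - indexFun a b p.2 (x i)) ^ 2 +
          D₁ * 2 ^ k) →
      (∀ p ∈ indexPairs d a b,
        n * ∫ x, (indexFun a b p.1 x - indexFun a b p.2 x) ^ 2 ∂P ≤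
        8 * ∑ i ∈ Finset.range n, (indexFun a b p.1 (x i) - indexFun a b p.2 (x i)) ^ 2 +
          D₂ * 2 ^ k) →
      roughness (Icc a b) m ≤ ENNReal.ofReal (B + 1) ∧
      supNormOn (Icc a b) m ≤ ENNReal.ofReal (B + 1) ∧
      eLpNorm (fun x : EuclideanSpace ℝ (Fin d) => m (inner ℝ θ x) - m₀ (inner ℝ θ₀ x)) 2 P ≤
        ENNReal.ofReal (B + 1) * ‖lam‖ₑ := by
  obtain ⟨C₁, hC₁, hsize⟩ := exists_abs_le_roughness_add_norm hab h4 hT hD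
  set J₀ := √(roughnessSq (Icc a b) m₀).toReal with hJ₀def
  set F₀ := √(∫ x, indexFun a b (m₀, θ₀) x ^ 2 ∂P) with hF₀
  obtain ⟨B, δ, hB, hδ, hbd⟩ := exists_bound_of_basic_inequality (C₁ := C₁) (D₁ := D₁) (D₂ := D₂)
    (M := M) (J₀ := J₀) (F₀ := F₀) hC₁ hD₂ hM
  refine ⟨B, δ, hB.le, hδ, ?_⟩
  intro n k x y lam m θ hn hx hlam hlam1 hρM hρδ hest h1 h2
  obtain ⟨hJ, hbasic⟩ := hest.basic_inequality hn hlam hm₀ hθ₀ hJ₀ hx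
  obtain ⟨hm, hθ, -⟩ := hest
  set J := √(roughnessSq (Icc a b) m).toReal with hJdef
  set F := √(∫ x, indexFun a b (m, θ) x ^ 2 ∂P) with hF
  have hJ0 : 0 ≤ J := Real.sqrt_nonneg _
  have hF0 : 0 ≤ F := Real.sqrt_nonneg _
  have hJ₀0 : 0 ≤ J₀ := Real.sqrt_nonneg _
  have hF₀0 : 0 ≤ F₀ := Real.sqrt_nonneg _
  set S := 1 + C₁ * (J + F) + C₁ * (J₀ + F₀) with hS
  have u1 : 0 ≤ C₁ * (J + F) := by positivity
  have u2 : 0 ≤ C₁ * (J₀ + F₀) := by positivity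
  have hS1 : 1 ≤ S := by linarith
  have hm1 : ∀ t ∈ Icc a b, |m t| ≤ S := fun t ht =>
    ((hsize m hm hJ θ hθ t ht).1).trans (by linarith)
  have hm2 : ∀ t ∈ Icc a b, |derivWithin m (Icc a b) t| ≤ S := fun t ht =>
    ((hsize m hm hJ θ hθ t ht).2).trans (by linarith)
  have hm3 : ∀ t ∈ Icc a b, |m₀ t| ≤ S := fun t ht =>
    ((hsize m₀ hm₀ hJ₀ θ₀ hθ₀ t ht).1).trans (by linarith)
  have hm4 : ∀ t ∈ Icc a b, |derivWithin m₀ (Icc a b) t| ≤ S := fun t ht =>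
    ((hsize m₀ hm₀ hJ₀ θ₀ hθ₀ t ht).2).trans (by linarith)
  have hS0 : 0 < S := by linarith
  obtain ⟨g1, g2⟩ := error_bounds_of_scale (P := P) hn (x := x)
    (e := fun i => y i - indexFun a b (m₀, θ₀) (x i)) hS1
    ⟨⟨classR.div_mem_unitClass hm hS0 hm1 hm2, hθ⟩,
      ⟨classR.div_mem_unitClass hm₀ hS0 hm3 hm4, hθ₀⟩⟩ h1 h2
  have hmem : ∀ m ∈ classR (Icc a b), ∀ θ, MemLp (indexFun a b (m, θ)) 2 P := by
    intro m hm θ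
    obtain ⟨Bm, hBm⟩ := isCompact_Icc.exists_bound_of_continuousOn (classR.continuousOn hm)
    exact MemLp.of_bound
      (continuous_indexFun hab.le (classR.continuousOn hm) θ).aestronglyMeasurable Bm
      (ae_of_all _ fun x => hBm _ (clamp_mem hab.le _))
  have i1 := hmem m hm θ
  have i2 := hmem m₀ hm₀ θ₀
  have i3 := i1.sub i2
  set p := ∫ x, (indexFun a b (m, θ) x - indexFun a b (m₀, θ₀) x) ^ 2 ∂P with hp
  have i4 : Integrable (fun x => 2 * (indexFun a b (m, θ) x - indexFun a b (m₀, θ₀) x) ^ 2) P :=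
    i3.integrable_sq.const_mul 2
  have i5 : Integrable (fun x => 2 * indexFun a b (m₀, θ₀) x ^ 2) P := i2.integrable_sq.const_mul 2
  have hFp : F ^ 2 ≤ 2 * p + 2 * F₀ ^ 2 := by
    rw [hF, hF₀, Real.sq_sqrt (integral_nonneg fun _ => sq_nonneg _),
      Real.sq_sqrt (integral_nonneg fun _ => sq_nonneg _), hp, ← integral_const_mul,
      ← integral_const_mul, ← integral_add i4 i5]
    refine integral_mono i1.integrable_sq (i4.add i5) fun x => ?_
    nlinarith [sq_nonneg (indexFun a b (m, θ) x - 2 * indexFun a b (m₀, θ₀) x)]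
  have hn0 : (0 : ℝ) < n := by exact_mod_cast hn
  rw [← Real.sq_sqrt (ENNReal.toReal_nonneg (a := roughnessSq (Icc a b) m)),
    ← Real.sq_sqrt (ENNReal.toReal_nonneg (a := roughnessSq (Icc a b) m₀))] at hbasic
  obtain ⟨r1, r2, r3⟩ := hbd _ p J F _ _ (lam ^ 2) S
    (div_nonneg (Finset.sum_nonneg fun _ _ => sq_nonneg _) hn0.le) (by positivity) hρδ hρM
    (by positivity) hlam1 hS hS1 g2 g1 hbasic hFp
  have hSB : S ≤ B + 1 := by nlinarith
  refine ⟨?_, ?_, ?_⟩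
  · have e : roughnessSq (Icc a b) m = ENNReal.ofReal (J ^ 2) := by
      rw [hJdef, Real.sq_sqrt ENNReal.toReal_nonneg, ENNReal.ofReal_toReal hJ]
    rw [roughness, e, ENNReal.ofReal_rpow_of_nonneg (sq_nonneg _) (by norm_num),
      ← Real.sqrt_eq_rpow]
    exact ENNReal.ofReal_le_ofReal ((Real.sqrt_le_sqrt r1).trans (le_sqrt_add_one B hB.le))
  · refine iSup₂_le fun t ht => ?_
    rw [← ofReal_norm]
    exact ENNReal.ofReal_le_ofReal ((hm1 t ht).trans hSB)
  · have hae : (fun x : EuclideanSpace ℝ (Fin d) => m (inner ℝ θ x) - m₀ (inner ℝ θ₀ x)) =ᵐ[P]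
        (indexFun a b (m, θ) - indexFun a b (m₀, θ₀)) := by
      filter_upwards [hD θ hθ, hD θ₀ hθ₀] with x hx1 hx2
      rw [Pi.sub_apply, indexFun_eq hx1, indexFun_eq hx2]
    rw [eLpNorm_congr_ae hae]
    exact eLpNorm_two_le_of_integral_sq_le i3 hB.le r3

end ConvexSIM

theorem mainTheorem7 {d : ℕ} [NeZero d] {Ω : Type*} [MeasurableSpace Ω]
    (μ : Measure Ω) [IsProbabilityMeasure μ]
    -- the true index vector and link function
    (θ₀ : EuclideanSpace ℝ (Fin d)) (m₀ : ℝ → ℝ) (hθ₀ : θ₀ ∈ ConvexSIM.Theta d)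
    -- i.i.d. data
    (X : ℕ → Ω → EuclideanSpace ℝ (Fin d)) (Y : ℕ → Ω → ℝ)
    (hX : ∀ i, Measurable (X i)) (hY : ∀ i, Measurable (Y i))
    (hindep : iIndepFun (fun i ω => (X i ω, Y i ω)) μ)
    (hident : ∀ i, IdentDistrib (fun ω => (X i ω, Y i ω)) (fun ω => (X 0 ω, Y 0 ω)) μ μ)
    -- the law of the covariate and the index set
    (P : Measure (EuclideanSpace ℝ (Fin d))) (hP : P = μ.map (X 0))
    (D : Set ℝ) (hD : D = ConvexSIM.indexSet P)
    -- the assumptions on the model; the error is `Y - m₀(θ₀ᵀX)`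
    (hA0 : ConvexSIM.AssumptionA0 P θ₀)
    (hA1 : ConvexSIM.AssumptionA1 P)
    (hA2 : ConvexSIM.AssumptionA2 μ (X 0) (fun ω => Y 0 ω - m₀ (inner ℝ θ₀ (X 0 ω))))
    (hA3 : ConvexSIM.AssumptionA3 P m₀ θ₀)
    (hA4 : ConvexSIM.AssumptionA4 P)
    (hP1 : ConvexSIM.AssumptionP1 D m₀)
    -- the random smoothing parameter
    (lam : ℕ → Ω → ℝ) (hlam : ∀ n, Measurable (lam n))
    (hlam0 : ∀ n, 1 ≤ n → ∀ᵐ ω ∂μ, lam n ω ≠ 0)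
    (hP2 : ConvexSIM.AssumptionP2 μ lam)
    -- the penalized least squares estimator based on the first `n` observations
    (mhat : ℕ → Ω → ℝ → ℝ) (θhat : ℕ → Ω → EuclideanSpace ℝ (Fin d))
    (hPLSE : ∀ n, 1 ≤ n → ∀ᵐ ω ∂μ,
      ConvexSIM.IsPLSE D n (fun i => X i ω) (fun i => Y i ω) (lam n ω) (mhat n ω) (θhat n ω)) :
    ConvexSIM.IsBigOp μ (fun n ω => ConvexSIM.roughness D (mhat n ω)) (fun _ _ => 1) ∧
    ConvexSIM.IsBigOp μ (fun n ω => ConvexSIM.supNormOn D (mhat n ω)) (fun _ _ => 1) ∧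
    ConvexSIM.IsBigOp μ
      (fun n ω => eLpNorm (fun x : EuclideanSpace ℝ (Fin d) =>
        mhat n ω (inner ℝ (θhat n ω) x) - m₀ (inner ℝ θ₀ x)) 2 P)
      (fun n ω => ‖lam n ω‖ₑ) := by
  obtain ⟨hm₀, -, hJ₀'⟩ := hP1
  obtain ⟨a, b, hab, hI⟩ :=
    ConvexSIM.exists_indexSet_eq_Icc hθ₀ hA0 hA1 (by rw [← hD]; exact hm₀.1.1)
  have hDI : D = Icc a b := hD.trans hI
  clear hD
  subst hDI
  have hJ₀ : ConvexSIM.roughnessSq (Icc a b) m₀ ≠ ∞ := by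
    intro h
    rw [ConvexSIM.roughness, h, ENNReal.top_rpow_of_pos (by norm_num)] at hJ₀'
    exact lt_irrefl _ hJ₀'
  have hPprob : IsProbabilityMeasure P := by
    rw [hP]; exact Measure.isProbabilityMeasure_map (hX 0).aemeasurable
  obtain ⟨-, T, hT⟩ := hA1
  have hχP : ∀ᵐ x ∂P, x ∈ P.support := Measure.support_mem_ae
  have hχI : ∀ θ ∈ ConvexSIM.Theta d, ∀ x ∈ P.support, (inner ℝ θ x : ℝ) ∈ Icc a b :=
    fun θ hθ x hx => hI ▸ ⟨θ, hθ, x, hx, rfl⟩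
  have hidX : ∀ i, IdentDistrib (X i) (X 0) μ μ := fun i =>
    (hident i).comp (u := Prod.fst) measurable_fst
  have hindX : iIndepFun X μ := hindep.comp (fun _ => Prod.fst) fun _ => measurable_fst
  have hχ : ∀ᵐ ω ∂μ, ∀ i, X i ω ∈ P.support := by
    rw [ae_all_iff]
    intro i
    refine ae_of_ae_map (hX i).aemeasurable ?_
    rw [(hidX i).map_eq, ← hP]
    exact hχP
  -- a measurable version of the errors
  set f₀ : EuclideanSpace ℝ (Fin d) → ℝ := ConvexSIM.indexFun a b (m₀, θ₀) with hf₀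
  have hf₀m : Measurable f₀ :=
    (ConvexSIM.continuous_indexFun hab.le (ConvexSIM.classR.continuousOn hm₀) θ₀).measurable
  set e : ℕ → Ω → ℝ := fun i ω => Y i ω - f₀ (X i ω) with he
  have hem : ∀ i, Measurable (e i) := fun i => (hY i).sub (hf₀m.comp (hX i))
  have hpair : Measurable fun z : EuclideanSpace ℝ (Fin d) × ℝ => (z.1, z.2 - f₀ z.1) := by
    fun_prop
  have hinde : iIndepFun (fun i ω => (X i ω, e i ω)) μ :=
    hindep.comp (fun _ z => (z.1, z.2 - f₀ z.1)) fun _ => hpair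
  have hide : ∀ i, IdentDistrib (fun ω => (X i ω, e i ω)) (fun ω => (X 0 ω, e 0 ω)) μ μ :=
    fun i => (hident i).comp hpair
  have heq : (fun ω => Y 0 ω - m₀ (inner ℝ θ₀ (X 0 ω))) =ᵐ[μ] e 0 := by
    filter_upwards [hχ] with ω hω
    simp only [he, hf₀]
    rw [ConvexSIM.indexFun_eq (hχI θ₀ hθ₀ _ (hω 0))]
  have heint : ∫⁻ ω, ‖e 0 ω‖ₑ ∂μ ≠ ∞ := (hA2.1.congr heq).2.ne
  obtain ⟨c, hc0, hc'⟩ := hA2.exists_lintegral_exp_le_one (hX 0)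
  have hc : ∀ h : EuclideanSpace ℝ (Fin d) → ℝ, Measurable h → ∀ B : ℝ, (∀ x, |h x| ≤ B) →
      ∫⁻ ω, ENNReal.ofReal (Real.exp (h (X 0 ω) * e 0 ω - c * h (X 0 ω) ^ 2)) ∂μ ≤ 1 := by
    intro h hh B hB
    refine le_trans (lintegral_congr_ae ?_).le (hc' h hh B hB)
    filter_upwards [heq] with ω hω
    rw [hω]
  -- the two empirical process bounds
  obtain ⟨A, C, hG⟩ := ConvexSIM.exists_hasConvexEntropy hab hχI hT
  obtain ⟨D₁, hD₁, hmult⟩ := ConvexSIM.exists_measure_multiplier_le hG hX hem hinde hide hχ hc0 hc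
    (s := 1 / 8) (by norm_num)
  obtain ⟨D₂, hD₂, hnorm⟩ := ConvexSIM.exists_measure_norm_le hG hX hindX hidX hP hχP hχ
  have key : ∀ ε : ℝ≥0∞, 0 < ε → ∃ B : ℝ, ∀ᶠ n in atTop, μ {ω | ¬
      (ConvexSIM.roughness (Icc a b) (mhat n ω) ≤ ENNReal.ofReal B ∧
      ConvexSIM.supNormOn (Icc a b) (mhat n ω) ≤ ENNReal.ofReal B ∧
      eLpNorm (fun x : EuclideanSpace ℝ (Fin d) =>
        mhat n ω (inner ℝ (θhat n ω) x) - m₀ (inner ℝ θ₀ x)) 2 P ≤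
        ENNReal.ofReal B * ‖lam n ω‖ₑ)} ≤ ε := by
    intro ε hε
    -- five exceptional events share the probability `ε`
    set η : ℝ≥0∞ := min ε 1 / 5 with hη
    have hη0 : 0 < η := ENNReal.div_pos (lt_min hε one_pos).ne' (by norm_num)
    have hηt : η ≠ ∞ := (ENNReal.div_lt_top (ne_top_of_le_ne_top ENNReal.one_ne_top
      (min_le_right _ _)) (by norm_num)).ne
    have hη5 : η + (η + (η + (η + η))) ≤ ε := by
      have : η + (η + (η + (η + η))) = 5 * η := by ring
      rw [this, hη, ENNReal.mul_div_cancel (by norm_num) (by norm_num)]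
      exact min_le_left _ _
    obtain ⟨M, hM⟩ := hP2.1 η hη0
    have hlam1 := (hP2.2 1 one_pos).eventually_lt_const hη0
    -- a bound for the mean absolute error, up to a small probability
    set L : ℝ := ((∫⁻ ω, ‖e 0 ω‖ₑ ∂μ) / η).toReal + 1 with hL
    have hL0 : 0 < L := by positivity
    have hLη : (∫⁻ ω, ‖e 0 ω‖ₑ ∂μ) / ENNReal.ofReal L ≤ η := by
      have h1 : (∫⁻ ω, ‖e 0 ω‖ₑ ∂μ) / η ≤ ENNReal.ofReal L := by
        rw [← ENNReal.ofReal_toReal (ENNReal.div_ne_top heint hη0.ne')]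
        exact ENNReal.ofReal_le_ofReal (by rw [hL]; linarith)
      rw [ENNReal.div_le_iff hη0.ne' hηt] at h1
      rw [ENNReal.div_le_iff (ENNReal.ofReal_pos.2 hL0).ne' ENNReal.ofReal_ne_top, mul_comm]
      exact h1
    obtain ⟨B, δ, hB, hδ, hbd⟩ := ConvexSIM.exists_bound_of_empirical_bounds hab hA4
      (hχP.mono hT) (fun θ hθ => hχP.mono (hχI θ hθ)) hm₀ hθ₀ hJ₀ (D₁ := D₁ * (1 + L)) hD₂
      (M := (M : ℝ) ^ 2 + 1) (by have := sq_nonneg (M : ℝ); linarith)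
    refine ⟨B + 1, ?_⟩
    have t3 := (ConvexSIM.tendsto_ofReal_div_two_pow 3).eventually_lt_const hη0
    have t1 := (ConvexSIM.tendsto_ofReal_div_two_pow 1).eventually_lt_const hη0
    have tδ := (ConvexSIM.tendsto_ofReal_div_two_pow 1).eventually_lt_const
      (ENNReal.ofReal_pos.2 hδ)
    filter_upwards [hM, hlam1, t3, t1, tδ, eventually_ge_atTop 1] with n hn1 hn2 hn3 hn4 hn5 hn
    -- with this choice `2 ^ k` is of order `n ^ (1/5)`
    set k := Nat.log 32 n with hk
    have hk1 : 32 ^ k ≤ n := Nat.pow_log_le_self 32 (by omega)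
    have hk2 : n ≤ 32 * 32 ^ k := by
      have := Nat.lt_pow_succ_log_self (b := 32) (by norm_num) n
      rw [pow_succ, ← hk] at this
      omega
    have hρδ : (2 : ℝ) ^ k / n ≤ δ := by
      have h1 : (1 : ℝ) / 2 ^ k < δ := (ENNReal.ofReal_lt_ofReal_iff hδ).1 hn5
      have hn0 : (0 : ℝ) < n := by exact_mod_cast hn
      have h2 : (2 : ℝ) ^ k / n ≤ 1 / 2 ^ k := by
        rw [div_le_div_iff₀ hn0 (by positivity), one_mul, ← mul_pow]
        calc ((2 : ℝ) * 2) ^ k ≤ 32 ^ k := by gcongr; norm_num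
          _ ≤ n := by exact_mod_cast hk1
      linarith
    have hm := hmult n k L hL0 hn hk2
    have hno := hnorm n k hk2
    -- outside of these events the deterministic bounds apply
    set E₁ := {ω | ∃ p ∈ ConvexSIM.indexPairs d a b, 1 / 8 * ∑ i ∈ Finset.range n,
      (ConvexSIM.indexFun a b p.1 (X i ω) - ConvexSIM.indexFun a b p.2 (X i ω)) ^ 2 +
        D₁ * (1 + L) * 2 ^ k < ∑ i ∈ Finset.range n, e i ω *
      (ConvexSIM.indexFun a b p.1 (X i ω) - ConvexSIM.indexFun a b p.2 (X i ω))} with hE₁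
    set E₂ := {ω | ∃ p ∈ ConvexSIM.indexPairs d a b, 8 * ∑ i ∈ Finset.range n,
      (ConvexSIM.indexFun a b p.1 (X i ω) - ConvexSIM.indexFun a b p.2 (X i ω)) ^ 2 +
        D₂ * 2 ^ k < n * ∫ x,
      (ConvexSIM.indexFun a b p.1 x - ConvexSIM.indexFun a b p.2 x) ^ 2 ∂P} with hE₂
    set E₃ := {ω | (M : ℝ≥0∞) * (n : ℝ≥0∞) ^ (2 / 5 : ℝ) < ‖lam n ω‖ₑ⁻¹} with hE₃
    set E₄ := {ω | ((1 : ℝ≥0) : ℝ≥0∞) * (n : ℝ≥0∞) ^ (-(1 / 4) : ℝ) < ‖lam n ω‖ₑ} with hE₄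
    have hsub : ∀ᵐ ω ∂μ, ω ∈ {ω | ¬
        (ConvexSIM.roughness (Icc a b) (mhat n ω) ≤ ENNReal.ofReal (B + 1) ∧
        ConvexSIM.supNormOn (Icc a b) (mhat n ω) ≤ ENNReal.ofReal (B + 1) ∧
        eLpNorm (fun x : EuclideanSpace ℝ (Fin d) =>
          mhat n ω (inner ℝ (θhat n ω) x) - m₀ (inner ℝ θ₀ x)) 2 P ≤
          ENNReal.ofReal (B + 1) * ‖lam n ω‖ₑ)} → ω ∈ E₁ ∪ (E₂ ∪ (E₃ ∪ E₄)) := by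
      filter_upwards [hχ, hlam0 n hn, hPLSE n hn] with ω h1 h2 h3 h4
      by_contra hω
      simp only [mem_union, not_or] at hω
      obtain ⟨o1, o2, o3, o4⟩ := hω
      refine h4 (hbd n k (fun i => X i ω) (fun i => Y i ω) (lam n ω) (mhat n ω) (θhat n ω) hn
        (fun θ hθ i => hχI θ hθ _ (h1 i)) h2 ?_ ?_ hρδ h3 ?_ ?_)
      · refine ConvexSIM.sq_le_one_of_enorm_le hn ?_
        have o4' : ¬ (((1 : ℝ≥0) : ℝ≥0∞) * (n : ℝ≥0∞) ^ (-(1 / 4) : ℝ) < ‖lam n ω‖ₑ) := o4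
        have := not_lt.1 o4'
        rwa [ENNReal.coe_one, one_mul] at this
      · have h5 := ConvexSIM.two_pow_div_le_of_inv_le hn hk1 h2 (not_lt.1 o3)
        have := sq_nonneg (lam n ω)
        linarith
      · intro p hp
        by_contra hcon
        exact o1 ⟨p, hp, not_le.1 hcon⟩
      · intro p hp
        by_contra hcon
        exact o2 ⟨p, hp, not_le.1 hcon⟩
    calc _ ≤ μ (E₁ ∪ (E₂ ∪ (E₃ ∪ E₄))) := measure_mono_ae hsub
      _ ≤ μ E₁ + (μ E₂ + (μ E₃ + μ E₄)) :=
        (measure_union_le _ _).trans (add_le_add_right ((measure_union_le _ _).trans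
          (add_le_add_right (measure_union_le _ _) _)) _)
      _ ≤ (η + η) + (η + (η + η)) := by
        refine add_le_add (hm.trans (add_le_add hn3.le hLη)) (add_le_add (hno.trans hn4.le)
          (add_le_add hn1 hn2.le))
      _ ≤ ε := by rw [add_assoc]; exact hη5
  refine ⟨fun ε hε => ?_, fun ε hε => ?_, fun ε hε => ?_⟩
  · obtain ⟨B, hB⟩ := key ε hε
    refine ⟨B.toNNReal, hB.mono fun n hn => (measure_mono fun ω hω hgood => ?_).trans hn⟩
    have hω' : ((B.toNNReal : ℝ≥0) : ℝ≥0∞) * 1 <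
        ConvexSIM.roughness (Icc a b) (mhat n ω) := hω
    rw [mul_one] at hω'
    exact absurd hgood.1 (not_le.2 hω')
  · obtain ⟨B, hB⟩ := key ε hε
    refine ⟨B.toNNReal, hB.mono fun n hn => (measure_mono fun ω hω hgood => ?_).trans hn⟩
    have hω' : ((B.toNNReal : ℝ≥0) : ℝ≥0∞) * 1 <
        ConvexSIM.supNormOn (Icc a b) (mhat n ω) := hω
    rw [mul_one] at hω'
    exact absurd hgood.2.1 (not_le.2 hω')
  · obtain ⟨B, hB⟩ := key ε hε
    refine ⟨B.toNNReal, hB.mono fun n hn => (measure_mono fun ω hω hgood => ?_).trans hn⟩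
    exact absurd hgood.2.2 (not_le.2 hω)
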